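/- Let $d\in\{2,3\}$, let $\Omega\subset\mathbb{R}^d$ be a bounded domain (non-empty, open, connected) with $C^2$ boundary $\Gamma$, and let $\eta,\kappa,\lambda>0$. All function spaces are complex. Let $$H=\{z\in (L^2(\Omega))^d:\ \nabla\cdot z=0 \text{ in }\Omega,\ z\cdot n=0\text{ on }\Gamma\},\qquad V=\{z\in (H^1_0(\Omega))^d:\ \nabla\cdot z=0\},$$ where $n$ is the unit outward normal and $z\cdot n|_\Gamma$ is the normal trace, let $P:(L^2(\Omega))^d\to H$ be the orthogonal (Leray) projection, and let $A_0=-P\Delta$ with $D(A_0)=(H^2(\Omega))^d\cap V$ be the Stokes operator in $H$. Let $\sigma_1\le\sigma_2\le\cdots$ be the eigenvalues of $A_0$, listed in nondecreasing order and repeated according to multiplicity. On $H\times H$ consider the operator $$\mathcal A=\begin{pmatrix}-\eta A_0&-\kappa A_0\\ I&-\lambda I\end{pmatrix},\qquad \mathcal A\begin{pmatrix}z\\ w\end{pmatrix}=\begin{pmatrix}-A_0(\eta z+\kappa w)\\ z-\lambda w\end{pmatrix},\qquad D(\mathcal A)=\left\{\begin{pmatrix}z\\ w\end{pmatrix}\in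 H\times H:\ \eta z+\kappa w\in D(A_0)\right\}.$$ For $k\ge1$ put $$\mu_k^\pm=\frac{-(\lambda+\eta\sigma_k)\pm\sqrt{(\lambda+\eta\sigma_k)^2-4\sigma_k(\eta\lambda+\kappa)}}{2}$$ (principal branch of the square root), and let $\nu_0=\frac{\kappa}{\eta}+\lambda$. Then the set of eigenvalues of $\mathcal A$ is $\{\mu_k^+:k\ge1\}\cup\{\mu_k^-:k\ge1\}$, and the following hold. (a) $\mathcal A$ has only finitely many non-real eigenvalues, and $\mu_k^\pm$ is non-real for only finitely many $k$. For every $k$, each of $\mu_k^+$ and $\mu_k^-$ is non-real if and only if $$\frac{(\eta\lambda+2\kappa)-2\sqrt{\kappa^2+\kappa\eta\lambda}}{\eta^2}<\sigma_k<\frac{(\eta\lambda+2\kappa)+2\sqrt{\kappa^2+\kappa\eta\lambda}}{\eta^2}.$$ (b) As $k\to\infty$, $\mu_k^+\to-\nu_0$, $\mu_k^-\sim-\eta\sigma_k$ (that is, the quotient tends to $1$), and $\operatorname{Re}\mu_k^-\to-\infty$. (c) All eigenvalues of $\mathcal A$ have negative real part. There are $N_1,N_2\in\mathbb{N}$, $N_1,N_2\ge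 1$, such that $$-\nu_0<\operatorname{Re}\mu_k^+<0\ \text{ for } 1\le k<N_1,\qquad \operatorname{Re}\mu_k^+\le-\nu_0\ \text{ for } k\ge N_1,$$ $$-\nu_0<\operatorname{Re}\mu_k^-<0\ \text{ for } 1\le k<N_2,\qquad \operatorname{Re}\mu_k^-\le-\nu_0\ \text{ for } k\ge N_2.$$ In particular, $\mathcal A$ has only finitely many eigenvalues with real part greater than $-\nu_0$. -/

import Mathlib

open MeasureTheory TopologicalSpace Filter
open scoped Topology

namespace StokesMemory

noncomputable section

/-! ### Function spaces on an open set `Ω ⊆ ℝ^d`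

All spaces are complex, so that complex eigenvalues make sense. -/

/-- `ℝ^d` with its Euclidean structure. -/
abbrev Space (d : ℕ) : Type := EuclideanSpace ℝ (Fin d)

/-- `L²(Ω)`. -/
abbrev L2Scalar {d : ℕ} (Ω : Opens (Space d)) : Type :=
  Lp ℂ 2 (volume.restrict (Ω : Set (Space d)))

/-- `(L²(Ω))^d`, with the norm `(∫_Ω |z(x)|² dx)^{1/2}`. -/
abbrev L2Vector {d : ℕ} (Ω : Opens (Space d)) : Type :=
  Lp (EuclideanSpace ℂ (Fin d)) 2 (volume.restrict (Ω : Set (Space d)))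

/-- The `j`-th component of a vector field. -/
def comp {d : ℕ} (Ω : Opens (Space d)) (j : Fin d) : L2Vector Ω →L[ℂ] L2Scalar Ω :=
  (EuclideanSpace.proj j : EuclideanSpace ℂ (Fin d) →L[ℂ] ℂ).compLpL 2
    (volume.restrict (Ω : Set (Space d)))

/-- The classical partial derivative `∂φ/∂x_i`. -/
def partialD {d : ℕ} {F : Type} [NormedAddCommGroup F] [NormedSpace ℝ F]
    (i : Fin d) (φ : Space d → F) (x : Space d) : F :=
  fderiv ℝ φ x (EuclideanSpace.single i 1)

/-- `g ∈ L²(Ω)` is the weak partial derivative `∂f/∂x_i` of `f ∈ L²(Ω)`. -/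
def HasWeakPartial {d : ℕ} (Ω : Opens (Space d)) (i : Fin d) (f g : L2Scalar Ω) : Prop :=
  ∀ φ : TestFunction Ω ℝ ⊤,
    ∫ x in (Ω : Set (Space d)), partialD i φ x • f x
      = - ∫ x in (Ω : Set (Space d)), φ x • g x

/-- `f ∈ H¹(Ω)`. -/
def IsH1 {d : ℕ} (Ω : Opens (Space d)) (f : L2Scalar Ω) : Prop :=
  ∀ i, ∃ g, HasWeakPartial Ω i f g

/-- `f ∈ H²(Ω)`. -/
def IsH2 {d : ℕ} (Ω : Opens (Space d)) (f : L2Scalar Ω) : Prop :=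
  ∀ i, ∃ g, HasWeakPartial Ω i f g ∧ IsH1 Ω g

/-- `L = Δf = ∑ ∂²f/∂x_i²`, the derivatives being weak derivatives in `L²(Ω)`. -/
def HasWeakLaplacian {d : ℕ} (Ω : Opens (Space d)) (f L : L2Scalar Ω) : Prop :=
  ∃ G K : Fin d → L2Scalar Ω,
    (∀ i, HasWeakPartial Ω i f (G i) ∧ HasWeakPartial Ω i (G i) (K i)) ∧ L = ∑ i, K i

/-- The pairs `(φ, ∇φ)` of a test function `φ ∈ C_c^∞(Ω)` and its gradient, in `L²`. -/
def testPairs {d : ℕ} (Ω : Opens (Space d)) : Set (L2Scalar Ω × (Fin d → L2Scalar Ω)) :=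
  {p | ∃ φ : TestFunction Ω ℂ ⊤,
    (p.1 =ᵐ[volume.restrict (Ω : Set (Space d))] φ) ∧
      ∀ i, p.2 i =ᵐ[volume.restrict (Ω : Set (Space d))] partialD i φ}

/-- `f ∈ H¹₀(Ω)`, the closure of `C_c^∞(Ω)` in `H¹(Ω)`: some sequence of test functions `φ_n`
satisfies `φ_n → f` in `L²` while the `∇φ_n` converge in `L²` (necessarily to `∇f`). -/
def IsH10 {d : ℕ} (Ω : Opens (Space d)) (f : L2Scalar Ω) : Prop :=
  ∃ g : Fin d → L2Scalar Ω, (f, g) ∈ closure (testPairs Ω)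

/-- `∇ · z = 0` in the sense of distributions. -/
def IsDivFree {d : ℕ} (Ω : Opens (Space d)) (z : L2Vector Ω) : Prop :=
  ∀ φ : TestFunction Ω ℝ ⊤,
    ∑ i, ∫ x in (Ω : Set (Space d)), partialD i φ x • comp Ω i z x = 0

/-- `g = ∇p` for some `p ∈ H¹(Ω)`. -/
def IsGradient {d : ℕ} (Ω : Opens (Space d)) (g : L2Vector Ω) : Prop :=
  ∃ p : L2Scalar Ω, ∀ i, HasWeakPartial Ω i p (comp Ω i g)

/-! ### Elementary facts about weak derivatives -/

section Helpers

variable {d : ℕ} {Ω : Opens (Space d)}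

lemma partialD_continuous (i : Fin d) (φ : TestFunction Ω ℝ ⊤) :
    Continuous (partialD i φ) := by
  have h := φ.contDiff.continuous_fderiv (by simp)
  exact h.clm_apply continuous_const

lemma partialD_hasCompactSupport (i : Fin d) (φ : TestFunction Ω ℝ ⊤) :
    HasCompactSupport (partialD i φ) :=
  φ.hasCompactSupport.fderiv_apply ℝ (EuclideanSpace.single i 1)

lemma integrable_smul {ψ : Space d → ℝ} (hc : Continuous ψ) (hs : HasCompactSupport ψ)
    (f : L2Scalar Ω) :
    Integrable (fun x => ψ x • f x) (volume.restrict (Ω : Set (Space d))) := by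
  have h1 : MemLp ψ 2 (volume.restrict (Ω : Set (Space d))) := hc.memLp_of_hasCompactSupport hs
  exact memLp_one_iff_integrable.1 ((Lp.memLp f).smul h1)

lemma integral_smul_add {ψ : Space d → ℝ} (hc : Continuous ψ) (hs : HasCompactSupport ψ)
    (f g : L2Scalar Ω) :
    ∫ x in (Ω : Set (Space d)), ψ x • (f + g : L2Scalar Ω) x
      = (∫ x in (Ω : Set (Space d)), ψ x • f x) + ∫ x in (Ω : Set (Space d)), ψ x • g x := by
  rw [← integral_add (integrable_smul hc hs f) (integrable_smul hc hs g)]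
  refine integral_congr_ae ?_
  filter_upwards [Lp.coeFn_add f g] with x hx
  rw [hx, Pi.add_apply, smul_add]

lemma integral_smul_smul (ψ : Space d → ℝ) (c : ℂ) (f : L2Scalar Ω) :
    ∫ x in (Ω : Set (Space d)), ψ x • (c • f : L2Scalar Ω) x
      = c * ∫ x in (Ω : Set (Space d)), ψ x • f x := by
  rw [← integral_const_mul]
  refine integral_congr_ae ?_
  filter_upwards [Lp.coeFn_smul c f] with x hx
  rw [hx, Pi.smul_apply, smul_eq_mul, mul_smul_comm]

lemma integral_smul_zero (ψ : Space d → ℝ) :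
    ∫ x in (Ω : Set (Space d)), ψ x • (0 : L2Scalar Ω) x = 0 := by
  have := integral_smul_smul ψ 0 (0 : L2Scalar Ω)
  simpa using this

lemma HasWeakPartial.add {i : Fin d} {f g f' g' : L2Scalar Ω} (h : HasWeakPartial Ω i f g)
    (h' : HasWeakPartial Ω i f' g') : HasWeakPartial Ω i (f + f') (g + g') := by
  intro φ
  rw [integral_smul_add (partialD_continuous i φ) (partialD_hasCompactSupport i φ),
    integral_smul_add φ.continuous φ.hasCompactSupport, h φ, h' φ]
  ring

lemma HasWeakPartial.smul {i : Fin d} {f g : L2Scalar Ω} (c : ℂ) (h : HasWeakPartial Ω i f g) :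
    HasWeakPartial Ω i (c • f) (c • g) := by
  intro φ
  rw [integral_smul_smul, integral_smul_smul, h φ]
  ring

lemma HasWeakPartial.zero (i : Fin d) : HasWeakPartial Ω i 0 0 := by
  intro φ
  rw [integral_smul_zero, integral_smul_zero, neg_zero]

/-- Weak derivatives are unique. -/
lemma HasWeakPartial.eq_zero {i : Fin d} {g : L2Scalar Ω} (h : HasWeakPartial Ω i 0 g) :
    g = 0 := by
  rw [Lp.eq_zero_iff_ae_eq_zero]
  have hloc : LocallyIntegrableOn (g : Space d → ℂ) (Ω : Set (Space d)) volume := by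
    rw [locallyIntegrableOn_iff Ω.isOpen.isLocallyClosed]
    intro K hK hKc
    have h2 : MemLp g 2 (volume.restrict K) :=
      (Lp.memLp g).mono_measure (Measure.restrict_mono hK le_rfl)
    have : IsFiniteMeasure (volume.restrict K) := ⟨by
      simpa using hKc.measure_lt_top⟩
    exact h2.integrable (by norm_num)
  have := Ω.isOpen.ae_eq_zero_of_integral_contDiff_smul_eq_zero hloc (by
    intro ψ h1 h2 h3
    have := h ⟨ψ, h1, h2, h3⟩
    rw [integral_smul_zero] at this
    have h0 : ∫ x in (Ω : Set (Space d)), ψ x • g x = 0 := by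
      have := this.symm
      rwa [neg_eq_zero] at this
    rw [← h0, setIntegral_eq_integral_of_forall_compl_eq_zero]
    intro x hx
    rw [image_eq_zero_of_notMem_tsupport (fun hx' => hx (h3 hx')), zero_smul])
  rw [Filter.EventuallyEq, ae_restrict_iff' Ω.isOpen.measurableSet]
  simpa using this

lemma IsH1.add {f g : L2Scalar Ω} (hf : IsH1 Ω f) (hg : IsH1 Ω g) : IsH1 Ω (f + g) := fun i => by
  obtain ⟨a, ha⟩ := hf i
  obtain ⟨b, hb⟩ := hg i
  exact ⟨a + b, ha.add hb⟩

lemma IsH1.smul {f : L2Scalar Ω} (c : ℂ) (hf : IsH1 Ω f) : IsH1 Ω (c • f) := fun i => by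
  obtain ⟨a, ha⟩ := hf i
  exact ⟨c • a, ha.smul c⟩

lemma IsH1.zero : IsH1 Ω 0 := fun i => ⟨0, HasWeakPartial.zero i⟩

lemma IsH2.add {f g : L2Scalar Ω} (hf : IsH2 Ω f) (hg : IsH2 Ω g) : IsH2 Ω (f + g) := fun i => by
  obtain ⟨a, ha, ha'⟩ := hf i
  obtain ⟨b, hb, hb'⟩ := hg i
  exact ⟨a + b, ha.add hb, ha'.add hb'⟩

lemma IsH2.smul {f : L2Scalar Ω} (c : ℂ) (hf : IsH2 Ω f) : IsH2 Ω (c • f) := fun i => by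
  obtain ⟨a, ha, ha'⟩ := hf i
  exact ⟨c • a, ha.smul c, ha'.smul c⟩

lemma IsH2.zero : IsH2 Ω 0 := fun i => ⟨0, HasWeakPartial.zero i, IsH1.zero⟩

lemma HasWeakLaplacian.add {f L f' L' : L2Scalar Ω} (h : HasWeakLaplacian Ω f L)
    (h' : HasWeakLaplacian Ω f' L') : HasWeakLaplacian Ω (f + f') (L + L') := by
  obtain ⟨G, K, h1, rfl⟩ := h
  obtain ⟨G', K', h1', rfl⟩ := h'
  exact ⟨G + G', K + K', fun i => ⟨(h1 i).1.add (h1' i).1, (h1 i).2.add (h1' i).2⟩,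
    by simp [Finset.sum_add_distrib]⟩

lemma HasWeakLaplacian.smul {f L : L2Scalar Ω} (c : ℂ) (h : HasWeakLaplacian Ω f L) :
    HasWeakLaplacian Ω (c • f) (c • L) := by
  obtain ⟨G, K, h1, rfl⟩ := h
  exact ⟨c • G, c • K, fun i => ⟨(h1 i).1.smul c, (h1 i).2.smul c⟩, by simp [Finset.smul_sum]⟩

lemma HasWeakLaplacian.zero : HasWeakLaplacian Ω 0 0 :=
  ⟨0, 0, fun i => ⟨HasWeakPartial.zero i, HasWeakPartial.zero i⟩, by simp⟩

lemma HasWeakLaplacian.eq_zero {L : L2Scalar Ω} (h : HasWeakLaplacian Ω 0 L) : L = 0 := by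
  obtain ⟨G, K, h1, rfl⟩ := h
  refine Finset.sum_eq_zero fun i _ => ?_
  have hG : G i = 0 := (h1 i).1.eq_zero
  have hK := (h1 i).2
  rw [hG] at hK
  exact hK.eq_zero

lemma testPairs_add {p q : L2Scalar Ω × (Fin d → L2Scalar Ω)} (hp : p ∈ testPairs Ω)
    (hq : q ∈ testPairs Ω) : p + q ∈ testPairs Ω := by
  obtain ⟨φ, h1, h2⟩ := hp
  obtain ⟨ψ, h3, h4⟩ := hq
  have hd : ∀ (χ : TestFunction Ω ℂ ⊤) x, DifferentiableAt ℝ χ x := fun χ x =>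
    (χ.contDiff.differentiable (by simp)) x
  refine ⟨φ + ψ, ?_, fun i => ?_⟩
  · filter_upwards [Lp.coeFn_add p.1 q.1, h1, h3] with x hx hx1 hx2
    rw [Prod.fst_add, hx, Pi.add_apply, hx1, hx2]
    rfl
  · filter_upwards [Lp.coeFn_add (p.2 i) (q.2 i), h2 i, h4 i] with x hx hx1 hx2
    rw [Prod.snd_add, Pi.add_apply, hx, Pi.add_apply, hx1, hx2]
    change _ = fderiv ℝ ((φ : Space d → ℂ) + (ψ : Space d → ℂ)) x _
    rw [fderiv_add (hd φ x) (hd ψ x)]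
    rfl

lemma testPairs_smul (c : ℂ) {p : L2Scalar Ω × (Fin d → L2Scalar Ω)} (hp : p ∈ testPairs Ω) :
    c • p ∈ testPairs Ω := by
  obtain ⟨φ, h1, h2⟩ := hp
  have hd : ∀ (χ : TestFunction Ω ℂ ⊤) x, DifferentiableAt ℝ χ x := fun χ x =>
    (χ.contDiff.differentiable (by simp)) x
  refine ⟨c • φ, ?_, fun i => ?_⟩
  · filter_upwards [Lp.coeFn_smul c p.1, h1] with x hx hx1
    rw [Prod.smul_fst, hx, Pi.smul_apply, hx1]
    rfl
  · filter_upwards [Lp.coeFn_smul c (p.2 i), h2 i] with x hx hx1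
    rw [Prod.smul_snd, Pi.smul_apply, hx, Pi.smul_apply, hx1]
    change _ = fderiv ℝ (c • (φ : Space d → ℂ)) x _
    rw [fderiv_const_smul (hd φ x)]
    rfl

lemma testPairs_zero : (0 : L2Scalar Ω × (Fin d → L2Scalar Ω)) ∈ testPairs Ω := by
  refine ⟨0, Lp.coeFn_zero _ _ _, fun i => ?_⟩
  filter_upwards [Lp.coeFn_zero ℂ 2 (volume.restrict (Ω : Set (Space d)))] with x hx
  change (0 : L2Scalar Ω) x = fderiv ℝ (0 : Space d → ℂ) x _
  rw [hx]
  simp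

lemma IsH10.add {f g : L2Scalar Ω} (hf : IsH10 Ω f) (hg : IsH10 Ω g) : IsH10 Ω (f + g) := by
  obtain ⟨a, ha⟩ := hf
  obtain ⟨b, hb⟩ := hg
  have h : (f, a) + (g, b) ∈ closure (testPairs Ω) :=
    map_mem_closure₂ continuous_add ha hb fun _ h _ h' => testPairs_add h h'
  exact ⟨a + b, h⟩

lemma IsH10.smul {f : L2Scalar Ω} (c : ℂ) (hf : IsH10 Ω f) : IsH10 Ω (c • f) := by
  obtain ⟨a, ha⟩ := hf
  have h : c • (f, a) ∈ closure (testPairs Ω) :=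
    map_mem_closure (continuous_const_smul c) ha fun _ h => testPairs_smul c h
  exact ⟨c • a, h⟩

lemma IsH10.zero : IsH10 Ω 0 := ⟨0, subset_closure testPairs_zero⟩

lemma IsDivFree.add {z w : L2Vector Ω} (hz : IsDivFree Ω z) (hw : IsDivFree Ω w) :
    IsDivFree Ω (z + w) := by
  intro φ
  simp only [map_add, integral_smul_add (partialD_continuous _ φ) (partialD_hasCompactSupport _ φ),
    Finset.sum_add_distrib, hz φ, hw φ, add_zero]

lemma IsDivFree.smul {z : L2Vector Ω} (c : ℂ) (hz : IsDivFree Ω z) : IsDivFree Ω (c • z) := by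
  intro φ
  simp only [map_smul, integral_smul_smul, ← Finset.mul_sum, hz φ, mul_zero]

lemma IsDivFree.zero : IsDivFree Ω 0 := by
  intro φ
  simp only [map_zero, integral_smul_zero, Finset.sum_const_zero]

lemma continuous_integral_smul {ψ : Space d → ℝ} (hc : Continuous ψ) (hs : HasCompactSupport ψ) :
    Continuous fun f : L2Scalar Ω => ∫ x in (Ω : Set (Space d)), ψ x • f x := by
  have hm : MemLp (fun x => (ψ x : ℂ)) 2 (volume.restrict (Ω : Set (Space d))) :=
    (hc.memLp_of_hasCompactSupport hs).ofReal
  have : (fun f : L2Scalar Ω => ∫ x in (Ω : Set (Space d)), ψ x • f x)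
      = fun f => inner ℂ (hm.toLp _) f := by
    funext f
    rw [L2.inner_def]
    refine integral_congr_ae ?_
    filter_upwards [hm.coeFn_toLp] with x hx
    rw [hx]
    simp [mul_comm]
  rw [this]
  fun_prop

end Helpers

/-! ### The spaces `H` and `V` and the Stokes operator -/

/-- The space `H` of all `z ∈ (L²(Ω))^d` with `∇ · z = 0` in `Ω` and `z · n = 0` on `∂Ω`.
The normal trace of a divergence-free field `z` is the functional `p ↦ ∫_Ω z · ∇p` on `H¹(Ω)`;
that it vanishes means that `z` is orthogonal to all gradients. -/
def solenoidal {d : ℕ} (Ω : Opens (Space d)) : Submodule ℂ (L2Vector Ω) where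
  carrier := {z | IsDivFree Ω z ∧ ∀ g : L2Vector Ω, IsGradient Ω g → inner ℂ g z = 0}
  zero_mem' := ⟨IsDivFree.zero, fun g _ => inner_zero_right g⟩
  add_mem' := fun ha hb => ⟨ha.1.add hb.1, fun g hg => by
    rw [inner_add_right, ha.2 g hg, hb.2 g hg, add_zero]⟩
  smul_mem' := fun c _ ha => ⟨ha.1.smul c, fun g hg => by
    rw [inner_smul_right, ha.2 g hg, mul_zero]⟩

theorem isClosed_solenoidal {d : ℕ} (Ω : Opens (Space d)) :
    IsClosed (solenoidal Ω : Set (L2Vector Ω)) := by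
  have h1 : IsClosed {z : L2Vector Ω | IsDivFree Ω z} := by
    simp only [IsDivFree, Set.ofPred_forall]
    refine isClosed_iInter fun φ => isClosed_eq ?_ continuous_const
    exact continuous_finsetSum _ fun i _ =>
      (continuous_integral_smul (partialD_continuous i φ) (partialD_hasCompactSupport i φ)).comp
        (comp Ω i).continuous
  have h2 : IsClosed {z : L2Vector Ω | ∀ g : L2Vector Ω, IsGradient Ω g → inner ℂ g z = 0} := by
    simp only [Set.ofPred_forall]
    refine isClosed_iInter fun g => isClosed_iInter fun _ => isClosed_eq ?_ continuous_const
    fun_prop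
  exact h1.inter h2

instance {d : ℕ} (Ω : Opens (Space d)) : CompleteSpace (solenoidal Ω) :=
  (isClosed_solenoidal Ω).completeSpace_coe

/-- The Leray projection `P : (L²(Ω))^d → H`. -/
def leray {d : ℕ} (Ω : Opens (Space d)) : L2Vector Ω →L[ℂ] solenoidal Ω :=
  (solenoidal Ω).orthogonalProjectionOnto

/-- The space `V = {z ∈ (H¹₀(Ω))^d : ∇ · z = 0}`. -/
def solenoidalH10 {d : ℕ} (Ω : Opens (Space d)) : Submodule ℂ (L2Vector Ω) where
  carrier := {z | (∀ j, IsH10 Ω (comp Ω j z)) ∧ IsDivFree Ω z}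
  zero_mem' := ⟨fun j => by rw [map_zero]; exact IsH10.zero, IsDivFree.zero⟩
  add_mem' := fun ha hb =>
    ⟨fun j => by rw [map_add]; exact (ha.1 j).add (hb.1 j), ha.2.add hb.2⟩
  smul_mem' := fun c _ ha => ⟨fun j => by rw [map_smul]; exact (ha.1 j).smul c, ha.2.smul c⟩

/-- The graph `{(u, -PΔu) : u ∈ (H²(Ω))^d ∩ V}` of the Stokes operator. -/
def stokesGraph {d : ℕ} (Ω : Opens (Space d)) :
    Submodule ℂ (solenoidal Ω × solenoidal Ω) where
  carrier := {p | (∀ j, IsH2 Ω (comp Ω j p.1)) ∧ (p.1 : L2Vector Ω) ∈ solenoidalH10 Ω ∧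
    ∃ L : L2Vector Ω, (∀ j, HasWeakLaplacian Ω (comp Ω j p.1) (comp Ω j L)) ∧
      p.2 = -leray Ω L}
  zero_mem' := by
    refine ⟨fun j => ?_, ?_, 0, fun j => ?_, ?_⟩
    · simpa using IsH2.zero
    · exact (solenoidalH10 Ω).zero_mem
    · simpa using HasWeakLaplacian.zero
    · simp
  add_mem' := by
    rintro a b ⟨ha1, ha2, L, ha3, ha4⟩ ⟨hb1, hb2, M, hb3, hb4⟩
    refine ⟨fun j => ?_, (solenoidalH10 Ω).add_mem ha2 hb2, L + M, fun j => ?_, ?_⟩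
    · simpa using (ha1 j).add (hb1 j)
    · simpa using (ha3 j).add (hb3 j)
    · rw [Prod.snd_add, ha4, hb4, map_add, neg_add]
  smul_mem' := by
    rintro c a ⟨ha1, ha2, L, ha3, ha4⟩
    refine ⟨fun j => ?_, (solenoidalH10 Ω).smul_mem c ha2, c • L, fun j => ?_, ?_⟩
    · simpa using (ha1 j).smul c
    · simpa using (ha3 j).smul c
    · rw [Prod.smul_snd, ha4, map_smul, smul_neg]

/-- The Stokes operator `A₀ = -PΔ` in `H`, with domain `D(A₀) = (H²(Ω))^d ∩ V`. -/
def stokesOp {d : ℕ} (Ω : Opens (Space d)) : solenoidal Ω →ₗ.[ℂ] solenoidal Ω :=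
  (stokesGraph Ω).toLinearPMap

lemma comp_injective {d : ℕ} {Ω : Opens (Space d)} {z : L2Vector Ω}
    (h : ∀ j, comp Ω j z = 0) : z = 0 := by
  rw [Lp.eq_zero_iff_ae_eq_zero]
  have h' : ∀ j, ∀ᵐ x ∂(volume.restrict (Ω : Set (Space d))), z x j = 0 := by
    intro j
    have h1 := (Lp.eq_zero_iff_ae_eq_zero).1 (h j)
    have h2 : comp Ω j z =ᵐ[volume.restrict (Ω : Set (Space d))] fun x => z x j :=
      ContinuousLinearMap.coeFn_compLpL _ _
    filter_upwards [h1, h2] with x hx1 hx2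
    rw [← hx2, hx1]
    rfl
  filter_upwards [ae_all_iff.2 h'] with x hx
  ext j
  simpa using hx j

/-- `stokesGraph` is the graph of `stokesOp`: the value `-PΔu` is determined by `u`. -/
theorem stokesOp_graph {d : ℕ} (Ω : Opens (Space d)) : (stokesOp Ω).graph = stokesGraph Ω := by
  refine Submodule.toLinearPMap_graph_eq _ ?_
  rintro ⟨u, f⟩ ⟨_, _, L, h1, h2⟩ (rfl : u = 0)
  have hL : L = 0 := comp_injective fun j => by
    have := h1 j
    rw [show comp Ω j (((0 : solenoidal Ω), f).1 : L2Vector Ω) = 0 by simp] at this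
    exact this.eq_zero
  rw [h2, hL, map_zero, neg_zero]

/-! ### Eigenvalues of unbounded operators -/

/-- The eigenspace `{x ∈ D(A) : A x = μ x}`. -/
def eigenspace {X : Type} [AddCommGroup X] [Module ℂ X] (A : X →ₗ.[ℂ] X) (μ : ℂ) :
    Submodule ℂ X :=
  A.graph.comap (LinearMap.id.prod (μ • LinearMap.id))

theorem mem_eigenspace {X : Type} [AddCommGroup X] [Module ℂ X] (A : X →ₗ.[ℂ] X) (μ : ℂ)
    (x : X) : x ∈ eigenspace A μ ↔ ∃ h : x ∈ A.domain, A ⟨x, h⟩ = μ • x := by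
  simp [eigenspace, LinearPMap.mem_graph_iff]

/-- `μ` is an eigenvalue of `A`. -/
def IsEigenvalue {X : Type} [AddCommGroup X] [Module ℂ X] (A : X →ₗ.[ℂ] X) (μ : ℂ) : Prop :=
  ∃ x ∈ eigenspace A μ, x ≠ 0

/-- `σ 0 ≤ σ 1 ≤ σ 2 ≤ …` is the nondecreasing list of the real eigenvalues of `A`, in which
every eigenvalue is repeated according to its multiplicity. -/
def IsEigenvalueSequence {X : Type} [AddCommGroup X] [Module ℂ X] (A : X →ₗ.[ℂ] X)
    (σ : ℕ → ℝ) : Prop :=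
  Monotone σ ∧
    ∀ s : ℝ, {k | σ k = s}.encard = Cardinal.toENat (Module.rank ℂ (eigenspace A (s : ℂ)))

/-! ### The principal operator -/

/-- The operator `𝒜 (z, w) = (-A₀ (η z + κ w), z - lam w)` in `X × X` (with the Hilbert norm), with
domain `D(𝒜) = {(z, w) : η z + κ w ∈ D(A₀)}`. -/
def principalOp {X : Type} [NormedAddCommGroup X] [InnerProductSpace ℂ X] (A₀ : X →ₗ.[ℂ] X)
    (η κ lam : ℝ) : WithLp 2 (X × X) →ₗ.[ℂ] WithLp 2 (X × X) where
  domain :=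
    { carrier := {Y | (η : ℂ) • Y.fst + (κ : ℂ) • Y.snd ∈ A₀.domain}
      zero_mem' := by simp
      add_mem' := fun {a b} ha hb => by
        have := A₀.domain.add_mem ha hb
        simp only [Set.mem_ofPred_eq, WithLp.add_fst, WithLp.add_snd, smul_add]
        rwa [add_add_add_comm] at this
      smul_mem' := fun c a ha => by
        have := A₀.domain.smul_mem c ha
        simp only [Set.mem_ofPred_eq, WithLp.smul_fst, WithLp.smul_snd]
        rwa [smul_add, smul_comm c, smul_comm c] at this }
  toFun :=
    { toFun := fun Y => WithLp.toLp 2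
        (-A₀ ⟨(η : ℂ) • Y.1.fst + (κ : ℂ) • Y.1.snd, Y.2⟩, Y.1.fst - (lam : ℂ) • Y.1.snd)
      map_add' := fun a b => by
        rw [← WithLp.toLp_add, Prod.mk_add_mk, ← neg_add, ← LinearPMap.map_add]
        congr 2
        · congr 2
          ext
          simp only [Submodule.coe_add, WithLp.add_fst, WithLp.add_snd, smul_add]
          rw [add_add_add_comm]
        · simp only [Submodule.coe_add, WithLp.add_fst, WithLp.add_snd, smul_add]
          abel
      map_smul' := fun c a => by
        rw [RingHom.id_apply, ← WithLp.toLp_smul, Prod.smul_mk, smul_neg, ← LinearPMap.map_smul]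
        congr 2
        · congr 2
          ext
          simp only [Submodule.coe_smul, WithLp.smul_fst, WithLp.smul_snd, smul_add]
          rw [smul_comm c, smul_comm c]
        · simp only [Submodule.coe_smul, WithLp.smul_fst, WithLp.smul_snd, smul_sub]
          rw [smul_comm c] }

/-- The discriminant `(lam + η s)² - 4 s (η lam + κ)`. -/
def discr (η κ lam s : ℝ) : ℝ := (lam + η * s) ^ 2 - 4 * s * (η * lam + κ)

/-- `μ⁺` for the Stokes eigenvalue `s`, with the principal branch of the square root. -/
def muPlus (η κ lam s : ℝ) : ℂ :=
  (-((lam + η * s : ℝ) : ℂ) + Complex.sqrt (discr η κ lam s : ℂ)) / 2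

/-- `μ⁻` for the Stokes eigenvalue `s`, with the principal branch of the square root. -/
def muMinus (η κ lam s : ℝ) : ℂ :=
  (-((lam + η * s : ℝ) : ℂ) - Complex.sqrt (discr η κ lam s : ℂ)) / 2

/-- The boundary of the open set `Ω` is of class `C²`: near each boundary point, `Ω` is the set
`{ρ < 0}` for a `C²` function `ρ` without critical points. -/
def HasC2Boundary {d : ℕ} (Ω : Opens (Space d)) : Prop :=
  ∀ x ∈ frontier (Ω : Set (Space d)), ∃ (U : Set (Space d)) (ρ : Space d → ℝ),
    IsOpen U ∧ x ∈ U ∧ ContDiffOn ℝ 2 ρ U ∧ (∀ y ∈ U, fderiv ℝ ρ y ≠ 0) ∧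
      ∀ y ∈ U, y ∈ Ω ↔ ρ y < 0

end

end StokesMemory

namespace StokesMemory

/-! ### Low frequencies control `H¹₀` -/

/-! The second row of the eigenvalue equation for `principalOp` gives `z = (lam + μ) w`. The first
row then says that `A₀` sends `(η (lam + μ) + κ) w` to `-μ (lam + μ) w`. The factor on the left
cannot vanish, so `w` is an eigenvector of `A₀`, and `μ` solves a quadratic equation whose parameter
is its eigenvalue (`isEigenvalue_principalOp_iff`). The rest needs two facts about the Stokes
operator and some algebra of the roots.

The Stokes eigenvalues are real and positive (`stokesOp_eigenvalue_pos`) and tend to infinity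
(`IsEigenvalueSequence.tendsto_atTop`). Both facts rest on one Fourier estimate. For `f ∈ H¹₀(Ω)`,
Plancherel bounds the mass at frequencies above `R` by `R⁻² ‖∇f‖²` (`norm_sq_le_lowFreq_add`).
Letting `R → 0` shows that `∇f = 0` forces `f = 0`, hence positivity. For a fixed large `R`,
orthonormal fields with bounded gradients keep half their mass in the ball of radius `R`. Bessel's
inequality against plane waves bounds the total low-frequency mass, so there are boundedly many such
fields (`exists_card_bound`). This takes the place of a compact embedding.

For the roots, put `ν₀ = κ/η + lam`. The shifted roots `μ⁺ + ν₀` and `μ⁻ + ν₀` have sum `2 ν₀ - (lam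
+ η s)` and product `(κ/η) ν₀ > 0`, which does not depend on `s`. The product makes `μ⁺ + ν₀` tend
to `0` because `μ⁻` diverges. Its positivity also gives both shifted roots real parts with the sign
of the sum, so one threshold in `s` serves both branches. -/

open scoped FourierTransform LineDeriv SchwartzMap in
/-- Plancherel's theorem bounds the high frequencies by the gradient. -/
lemma schwartz_integral_norm_sq_le {d : ℕ} (φ : 𝓢(Space d, ℂ)) {R : ℝ} (hR : 0 < R) :
    ∫ x, ‖φ x‖ ^ 2 ≤ (∫ ξ in Metric.closedBall (0 : Space d) R, ‖𝓕 φ ξ‖ ^ 2)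
      + (R ^ 2)⁻¹ * ∑ i, ∫ x, ‖partialD i φ x‖ ^ 2 := by
  have hint : ∀ ψ : 𝓢(Space d, ℂ), Integrable (fun x => ‖ψ x‖ ^ 2) := fun ψ =>
    (memLp_two_iff_integrable_sq_norm ψ.continuous.aestronglyMeasurable).1 (ψ.memLp 2)
  have hder : ∀ (i : Fin d) (ξ : Space d),
      ‖𝓕 (∂_{(EuclideanSpace.single i (1 : ℝ) : Space d)} φ) ξ‖ ^ 2
        = (2 * Real.pi) ^ 2 * ((ξ i) ^ 2 * ‖𝓕 φ ξ‖ ^ 2) := by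
    intro i ξ
    rw [SchwartzMap.fourier_lineDerivOp_eq, smul_apply,
      SchwartzMap.smulLeftCLM_apply_apply (by fun_prop)]
    simp [mul_pow, EuclideanSpace.inner_single_right]
  have hsum : ∑ i, ∫ x, ‖partialD i φ x‖ ^ 2
      = ∫ ξ, (2 * Real.pi) ^ 2 * (‖ξ‖ ^ 2 * ‖𝓕 φ ξ‖ ^ 2) := by
    have h1 : ∀ i : Fin d, ∫ x, ‖partialD i φ x‖ ^ 2
        = ∫ ξ, ‖𝓕 (∂_{(EuclideanSpace.single i (1 : ℝ) : Space d)} φ) ξ‖ ^ 2 := fun i => by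
      rw [SchwartzMap.integral_norm_sq_fourier]
      simp only [SchwartzMap.lineDerivOp_apply_eq_fderiv, partialD]
    simp_rw [h1]
    rw [← integral_finsetSum _ fun i _ => hint _]
    simp_rw [hder, ← Finset.mul_sum, ← Finset.sum_mul]
    congr 1 with ξ
    rw [EuclideanSpace.norm_sq_eq]
    simp
  have hint' : Integrable fun ξ => (2 * Real.pi) ^ 2 * (‖ξ‖ ^ 2 * ‖𝓕 φ ξ‖ ^ 2) := by
    have : (fun ξ : Space d => (2 * Real.pi) ^ 2 * (‖ξ‖ ^ 2 * ‖𝓕 φ ξ‖ ^ 2))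
        = fun ξ => ∑ i, ‖𝓕 (∂_{(EuclideanSpace.single i (1 : ℝ) : Space d)} φ) ξ‖ ^ 2 := by
      funext ξ
      simp_rw [hder, ← Finset.mul_sum, ← Finset.sum_mul]
      rw [EuclideanSpace.norm_sq_eq]
      simp
    rw [this]
    exact integrable_finsetSum _ fun i _ => hint _
  rw [hsum, ← SchwartzMap.integral_norm_sq_fourier, ← integral_indicator measurableSet_closedBall,
    ← integral_const_mul, ← integral_add ((hint (𝓕 φ)).indicator measurableSet_closedBall)
      (hint'.const_mul _)]
  refine integral_mono (hint _) (((hint (𝓕 φ)).indicator measurableSet_closedBall).add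
    (hint'.const_mul _)) fun ξ => ?_
  by_cases hξ : ξ ∈ Metric.closedBall (0 : Space d) R
  · simp only [Set.indicator_of_mem hξ]
    have : 0 ≤ (R ^ 2)⁻¹ * ((2 * Real.pi) ^ 2 * (‖ξ‖ ^ 2 * ‖𝓕 φ ξ‖ ^ 2)) := by positivity
    linarith
  · simp only [Set.indicator_of_notMem hξ, zero_add]
    have h1 : R < ‖ξ‖ := by simpa using hξ
    -- Outside the ball `‖ξ‖ > R`. The factor `(2π)² ≥ 1` is simply given away.
    have h2 : 1 ≤ (R ^ 2)⁻¹ * ((2 * Real.pi) ^ 2 * ‖ξ‖ ^ 2) := by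
      rw [le_inv_mul_iff₀ (by positivity), mul_one]
      have h3 : R ^ 2 ≤ ‖ξ‖ ^ 2 := by gcongr
      have h4 : 1 ≤ (2 * Real.pi) ^ 2 := one_le_pow₀ (by linarith [Real.pi_gt_three])
      nlinarith [sq_nonneg ‖ξ‖]
    nlinarith [sq_nonneg ‖𝓕 φ ξ‖]

/-- Passes from `Ω` to the whole space, where Plancherel applies; the representative `φ` vanishes
off `Ω`. -/
lemma norm_sq_eq_integral {d : ℕ} {Ω : Opens (Space d)} (f : L2Scalar Ω) {φ : Space d → ℂ}
    (hf : f =ᵐ[volume.restrict (Ω : Set (Space d))] φ)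
    (hφ : Function.support φ ⊆ Ω) : ‖f‖ ^ 2 = ∫ x, ‖φ x‖ ^ 2 := by
  have h1 : ((‖f‖ ^ 2 : ℝ) : ℂ) = ((∫ x in (Ω : Set (Space d)), ‖φ x‖ ^ 2 : ℝ) : ℂ) := by
    push_cast
    have := inner_self_eq_norm_sq_to_K (𝕜 := ℂ) f
    rw [L2.inner_def] at this
    refine this.symm.trans ?_
    rw [← integral_complex_ofReal]
    refine integral_congr_ae ?_
    filter_upwards [hf] with x hx
    rw [hx, inner_self_eq_norm_sq_to_K]
    simp
  have h2 := Complex.ofReal_injective h1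
  rw [h2, setIntegral_eq_integral_of_forall_compl_eq_zero]
  intro x hx
  rw [show φ x = 0 from by_contra fun h => hx (hφ h)]
  simp

lemma support_partialD_subset {d : ℕ} {Ω : Opens (Space d)} {F : Type} [NormedAddCommGroup F] [NormedSpace ℝ F]
    (φ : TestFunction Ω F ⊤) (i : Fin d) : Function.support (partialD i φ) ⊆ Ω := by
  intro x hx
  refine φ.tsupport_subset (support_fderiv_subset ℝ fun h => hx ?_)
  simp [partialD, h]

section PlaneWave

variable {d : ℕ} (Ω : Opens (Space d)) [IsFiniteMeasure (volume.restrict (Ω : Set (Space d)))]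

lemma memLp_planeWave (ξ : Space d) :
    MemLp (fun x : Space d => Complex.exp (((2 * Real.pi * inner ℝ x ξ : ℝ) : ℂ) * Complex.I)) 2
      (volume.restrict (Ω : Set (Space d))) :=
  MemLp.of_bound (Continuous.aestronglyMeasurable (by fun_prop)) 1
    (ae_of_all _ fun x => by rw [Complex.norm_exp_ofReal_mul_I])

/-- The plane wave `x ↦ exp(2πi x·ξ)` in `L²(Ω)`. -/
noncomputable def planeWave (ξ : Space d) : L2Scalar Ω := (memLp_planeWave Ω ξ).toLp _

lemma coeFn_planeWave (ξ : Space d) : planeWave Ω ξ =ᵐ[volume.restrict (Ω : Set (Space d))]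
    fun x => Complex.exp (((2 * Real.pi * inner ℝ x ξ : ℝ) : ℂ) * Complex.I) :=
  MemLp.coeFn_toLp _

lemma norm_planeWave_sq (ξ : Space d) :
    ‖planeWave Ω ξ‖ ^ 2 = volume.real (Ω : Set (Space d)) := by
  rw [← inner_self_eq_norm_sq (𝕜 := ℂ), L2.inner_def]
  have : ∫ x in (Ω : Set (Space d)), inner ℂ (planeWave Ω ξ x) (planeWave Ω ξ x)
      = ∫ x in (Ω : Set (Space d)), (1 : ℂ) := by
    refine integral_congr_ae ?_
    filter_upwards [coeFn_planeWave Ω ξ] with x hx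
    rw [hx, inner_self_eq_norm_sq_to_K, Complex.norm_exp_ofReal_mul_I]
    simp
  rw [this]
  simp

/-- The inner product conjugates its first argument, which produces the sign of the Fourier kernel.
Pairing with plane waves is thus the Fourier transform of `f` extended by zero. -/
lemma inner_planeWave (ξ : Space d) (f : L2Scalar Ω) : inner ℂ (planeWave Ω ξ) f
    = VectorFourier.fourierIntegral Real.fourierChar (volume.restrict (Ω : Set (Space d)))
        (innerₗ (Space d)) f ξ := by
  rw [L2.inner_def, VectorFourier.fourierIntegral]
  refine integral_congr_ae ?_
  filter_upwards [coeFn_planeWave Ω ξ] with x hx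
  rw [hx, Circle.smul_def, Real.fourierChar_apply, innerₗ_apply_apply, RCLike.inner_apply,
    ← Complex.exp_conj, smul_eq_mul, mul_comm]
  rw [map_mul, Complex.conj_ofReal, Complex.conj_I]
  congr 2
  push_cast
  ring

lemma continuous_inner_planeWave (f : L2Scalar Ω) :
    Continuous fun ξ => inner ℂ (planeWave Ω ξ) f := by
  simp_rw [inner_planeWave]
  refine VectorFourier.fourierIntegral_continuous Real.continuous_fourierChar ?_
    ((Lp.memLp f).integrable one_le_two)
  simp only [innerₗ_apply_apply]
  fun_prop

lemma norm_inner_planeWave_sq_le (f : L2Scalar Ω) (ξ : Space d) :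
    ‖inner ℂ (planeWave Ω ξ) f‖ ^ 2 ≤ volume.real (Ω : Set (Space d)) * ‖f‖ ^ 2 := by
  rw [← norm_planeWave_sq Ω ξ, ← mul_pow]
  gcongr
  exact norm_inner_le_norm _ _

/-- The part of `‖f‖²` carried by the frequencies `|ξ| ≤ R`. -/
noncomputable def lowFreq (R : ℝ) (f : L2Scalar Ω) : ℝ :=
  ∫ ξ in Metric.closedBall (0 : Space d) R, ‖inner ℂ (planeWave Ω ξ) f‖ ^ 2

lemma integrableOn_lowFreq (R : ℝ) (f : L2Scalar Ω) :
    IntegrableOn (fun ξ => ‖inner ℂ (planeWave Ω ξ) f‖ ^ 2) (Metric.closedBall (0 : Space d) R) :=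
  ((continuous_inner_planeWave Ω f).norm.pow 2).continuousOn.integrableOn_compact
    (isCompact_closedBall _ _)

/-- Dominated convergence on a ball of finite measure, with a bound uniform for `‖f‖ < ‖f₀‖ + 1`.
Continuity lets estimates for test functions pass to the closure defining `H¹₀`. -/
lemma continuous_lowFreq (R : ℝ) : Continuous (lowFreq Ω R) := by
  refine continuous_iff_continuousAt.2 fun f₀ => ?_
  refine continuousAt_of_dominated
    (bound := fun _ => volume.real (Ω : Set (Space d)) * (‖f₀‖ + 1) ^ 2) ?_ ?_ ?_ ?_
  · exact Eventually.of_forall fun f =>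
      ((continuous_inner_planeWave Ω f).norm.pow 2).aestronglyMeasurable
  · filter_upwards [continuous_norm.continuousAt.eventually (Iio_mem_nhds (lt_add_one ‖f₀‖))]
      with f hf
    refine ae_of_all _ fun ξ => ?_
    rw [Real.norm_of_nonneg (by positivity)]
    refine (norm_inner_planeWave_sq_le Ω f ξ).trans ?_
    gcongr
  · exact integrableOn_const (isCompact_closedBall _ _).measure_lt_top.ne
  · exact ae_of_all _ fun ξ => by fun_prop

lemma lowFreq_le (R : ℝ) (f : L2Scalar Ω) : lowFreq Ω R f ≤
    volume.real (Metric.closedBall (0 : Space d) R)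
      * (volume.real (Ω : Set (Space d)) * ‖f‖ ^ 2) := by
  refine (setIntegral_mono (integrableOn_lowFreq Ω R f)
    (integrableOn_const (isCompact_closedBall _ _).measure_lt_top.ne)
    (norm_inner_planeWave_sq_le Ω f)).trans ?_
  simp

variable {Ω}

/-- For `f ∈ H¹₀(Ω)`, the low frequencies and the gradient control the norm. -/
lemma norm_sq_le_lowFreq_add {f : L2Scalar Ω} {g : Fin d → L2Scalar Ω}
    (h : (f, g) ∈ closure (testPairs Ω)) {R : ℝ} (hR : 0 < R) :
    ‖f‖ ^ 2 ≤ lowFreq Ω R f + (R ^ 2)⁻¹ * ∑ i, ‖g i‖ ^ 2 := by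
  have hcl : IsClosed {p : L2Scalar Ω × (Fin d → L2Scalar Ω) |
      ‖p.1‖ ^ 2 ≤ lowFreq Ω R p.1 + (R ^ 2)⁻¹ * ∑ i, ‖p.2 i‖ ^ 2} := by
    have := continuous_lowFreq Ω R
    exact isClosed_le (by fun_prop) (by fun_prop)
  refine (hcl.closure_subset_iff.2 ?_ h : (f, g) ∈ _)
  rintro ⟨f, g⟩ ⟨φ, h1, h2⟩
  have hφ : Function.support φ ⊆ Ω := (subset_tsupport _).trans φ.tsupport_subset
  have key := schwartz_integral_norm_sq_le (φ.hasCompactSupport.toSchwartzMap φ.contDiff) hR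
  simp only [Set.mem_ofPred_eq]
  rw [norm_sq_eq_integral f h1 hφ]
  simp_rw [fun i => norm_sq_eq_integral (g i) (h2 i) (support_partialD_subset φ i)]
  refine key.trans_eq ?_
  congr 1
  rw [lowFreq]
  congr 1 with ξ
  congr 2
  rw [inner_planeWave, SchwartzMap.fourier_coe, Real.fourier_eq, VectorFourier.fourierIntegral]
  rw [← setIntegral_eq_integral_of_forall_compl_eq_zero (s := (Ω : Set (Space d)))]
  · refine integral_congr_ae ?_
    filter_upwards [h1] with x hx
    rw [hx]
    rfl
  · intro x hx
    rw [HasCompactSupport.toSchwartzMap_toFun φ.hasCompactSupport]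
    rw [show φ x = 0 from by_contra fun h => hx (hφ h), smul_zero]

/-- The Poincaré inequality, in qualitative form. -/
lemma eq_zero_of_grad_eq_zero (hd : d ≠ 0) {f : L2Scalar Ω}
    (h : (f, 0) ∈ closure (testPairs Ω)) : f = 0 := by
  -- With zero gradient, the low frequencies alone bound `‖f‖²` for every `R > 0`. Their mass is
  -- `O(R ^ d)`, which vanishes as `R → 0` because `d ≠ 0`.
  have hlim : Tendsto (fun R : ℝ => volume.real (Metric.closedBall (0 : Space d) R)
      * (volume.real (Ω : Set (Space d)) * ‖f‖ ^ 2)) (𝓝[>] 0) (𝓝 0) := by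
    have h1 : ∀ R ∈ Set.Ioi (0 : ℝ), R ^ d * volume.real (Metric.ball (0 : Space d) 1)
          * (volume.real (Ω : Set (Space d)) * ‖f‖ ^ 2)
        = volume.real (Metric.closedBall (0 : Space d) R)
          * (volume.real (Ω : Set (Space d)) * ‖f‖ ^ 2) := by
      intro R hR
      have hR' : (0 : ℝ) ≤ R := le_of_lt hR
      rw [Measure.real, Measure.real, Measure.real, Measure.addHaar_closedBall _ _ hR',
        finrank_euclideanSpace_fin, ENNReal.toReal_mul, ENNReal.toReal_ofReal (by positivity)]
    refine Tendsto.congr' (eventually_nhdsWithin_of_forall h1) ?_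
    refine tendsto_nhdsWithin_of_tendsto_nhds ?_
    have hc : Continuous fun R : ℝ => R ^ d * volume.real (Metric.ball (0 : Space d) 1)
          * (volume.real (Ω : Set (Space d)) * ‖f‖ ^ 2) := by fun_prop
    simpa [hd] using hc.tendsto 0
  have h2 : ‖f‖ ^ 2 ≤ 0 := by
    refine ge_of_tendsto hlim (eventually_nhdsWithin_of_forall fun R hR => ?_)
    have := norm_sq_le_lowFreq_add h hR
    simp only [Pi.zero_apply, norm_zero] at this
    refine le_trans ?_ (lowFreq_le Ω R f)
    simpa using this
  exact norm_eq_zero.1 (pow_eq_zero_iff two_ne_zero |>.1 (le_antisymm h2 (sq_nonneg _)))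

end PlaneWave

/-! ### Integration by parts -/

section Parts

variable {d : ℕ} {Ω : Opens (Space d)}

lemma HasWeakPartial.unique {i : Fin d} {f g g' : L2Scalar Ω} (h : HasWeakPartial Ω i f g)
    (h' : HasWeakPartial Ω i f g') : g = g' := by
  have := h.add (h'.smul (-1))
  rw [neg_one_smul, neg_one_smul, add_neg_cancel] at this
  exact add_neg_eq_zero.1 this.eq_zero

/-- The `L²`-limit of gradients of test functions is a weak gradient. -/
lemma hasWeakPartial_of_mem_closure {f : L2Scalar Ω} {g : Fin d → L2Scalar Ω}
    (h : (f, g) ∈ closure (testPairs Ω)) (i : Fin d) : HasWeakPartial Ω i f (g i) := by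
  intro ψ
  have hcl : IsClosed {p : L2Scalar Ω × (Fin d → L2Scalar Ω) |
      ∫ x in (Ω : Set (Space d)), partialD i ψ x • p.1 x
        = -∫ x in (Ω : Set (Space d)), ψ x • p.2 i x} := by
    have h1 := continuous_integral_smul (Ω := Ω) (partialD_continuous i ψ)
      (partialD_hasCompactSupport i ψ)
    have h2 := continuous_integral_smul (Ω := Ω) ψ.continuous ψ.hasCompactSupport
    exact isClosed_eq (h1.comp continuous_fst)
      (h2.comp ((continuous_apply i).comp continuous_snd)).neg
  refine (hcl.closure_subset_iff.2 ?_ h : (f, g) ∈ _)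
  rintro ⟨f, g⟩ ⟨φ, h1, h2⟩
  have hφc : Continuous (partialD i φ) :=
    (φ.contDiff.continuous_fderiv (by simp)).clm_apply continuous_const
  have e1 : ∫ x in (Ω : Set (Space d)), partialD i ψ x • f x = ∫ x, partialD i ψ x • φ x := by
    rw [← setIntegral_eq_integral_of_forall_compl_eq_zero (s := (Ω : Set (Space d)))
      (f := fun x => partialD i ψ x • φ x)]
    · refine integral_congr_ae ?_
      filter_upwards [h1] with x hx
      rw [hx]
    · intro x hx
      rw [show partialD i ψ x = 0 from by_contra fun h => hx (support_partialD_subset ψ i h),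
        zero_smul]
  have e2 : ∫ x in (Ω : Set (Space d)), ψ x • g i x = ∫ x, ψ x • partialD i φ x := by
    rw [← setIntegral_eq_integral_of_forall_compl_eq_zero (s := (Ω : Set (Space d)))
      (f := fun x => ψ x • partialD i φ x)]
    · refine integral_congr_ae ?_
      filter_upwards [h2 i] with x hx
      rw [hx]
    · intro x hx
      rw [show partialD i φ x = 0 from by_contra fun h => hx (support_partialD_subset φ i h),
        smul_zero]
  simp only [Set.mem_ofPred_eq]
  rw [e1, e2, eq_neg_iff_add_eq_zero, add_comm, ← eq_neg_iff_add_eq_zero]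
  refine integral_smul_fderiv_eq_neg_fderiv_smul_of_integrable ?_ ?_ ?_ ?_ ?_
  · exact ((partialD_continuous i ψ).smul φ.continuous).integrable_of_hasCompactSupport
      (partialD_hasCompactSupport i ψ).smul_right
  · exact (ψ.continuous.smul hφc).integrable_of_hasCompactSupport ψ.hasCompactSupport.smul_right
  · exact (ψ.continuous.smul φ.continuous).integrable_of_hasCompactSupport
      ψ.hasCompactSupport.smul_right
  · exact fun x _ => ψ.contDiff.differentiable (by simp) x
  · exact fun x _ => φ.contDiff.differentiable (by simp) x

/-- The composition of a complex test function with a real-linear functional. -/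
noncomputable def realPart (L : ℂ →L[ℝ] ℝ) (φ : TestFunction Ω ℂ ⊤) : TestFunction Ω ℝ ⊤ where
  toFun := fun x => L (φ x)
  contDiff' := L.contDiff.comp φ.contDiff
  hasCompactSupport' := φ.hasCompactSupport.comp_left (map_zero L)
  tsupport_subset' := (tsupport_comp_subset (map_zero L) φ).trans φ.tsupport_subset

lemma partialD_realPart (L : ℂ →L[ℝ] ℝ) (φ : TestFunction Ω ℂ ⊤) (i : Fin d) (x : Space d) :
    partialD i (realPart L φ) x = L (partialD i φ x) := by
  have hφ : DifferentiableAt ℝ φ x := φ.contDiff.differentiable (by simp) x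
  change fderiv ℝ (L ∘ φ) x _ = _
  rw [fderiv_comp x L.differentiableAt hφ]
  simp [partialD]

/-- Weak derivatives are tested against real functions, so the conjugate of a complex `φ` is split
into real and imaginary parts. -/
lemma inner_eq_integral_smul {u v : L2Scalar Ω} {φ : Space d → ℂ}
    (hu : u =ᵐ[volume.restrict (Ω : Set (Space d))] φ)
    (h1 : Integrable (fun x => (φ x).re • v x) (volume.restrict (Ω : Set (Space d))))
    (h2 : Integrable (fun x => (φ x).im • v x) (volume.restrict (Ω : Set (Space d)))) :
    inner ℂ u v = (∫ x in (Ω : Set (Space d)), (φ x).re • v x)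
      - Complex.I * ∫ x in (Ω : Set (Space d)), (φ x).im • v x := by
  rw [L2.inner_def, ← integral_const_mul, ← integral_sub h1 (h2.const_mul _)]
  refine integral_congr_ae ?_
  filter_upwards [hu] with x hx
  rw [hx, RCLike.inner_apply, Complex.real_smul, Complex.real_smul]
  have : (starRingEnd ℂ) (φ x) = (φ x).re - (φ x).im * Complex.I := by
    apply Complex.ext <;> simp
  rw [this]
  ring

/-- Green's formula for `f ∈ H¹₀(Ω)`. -/
lemma inner_weakPartial_of_mem_closure {f : L2Scalar Ω} {g : Fin d → L2Scalar Ω}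
    (h : (f, g) ∈ closure (testPairs Ω)) {i : Fin d} {G K : L2Scalar Ω}
    (hG : HasWeakPartial Ω i G K) : inner ℂ f K = -inner ℂ (g i) G := by
  have hcl : IsClosed {p : L2Scalar Ω × (Fin d → L2Scalar Ω) |
      inner ℂ p.1 K = -inner ℂ (p.2 i) G} := isClosed_eq (by fun_prop) (by fun_prop)
  refine (hcl.closure_subset_iff.2 ?_ h : (f, g) ∈ _)
  rintro ⟨f, g⟩ ⟨φ, h1, h2⟩
  have key : ∀ L : ℂ →L[ℝ] ℝ,
      Integrable (fun x => L (φ x) • K x) (volume.restrict (Ω : Set (Space d))) ∧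
      Integrable (fun x => L (partialD i φ x) • G x) (volume.restrict (Ω : Set (Space d))) ∧
      ∫ x in (Ω : Set (Space d)), L (partialD i φ x) • G x
        = -∫ x in (Ω : Set (Space d)), L (φ x) • K x := by
    intro L
    simp_rw [← partialD_realPart L φ i]
    exact ⟨integrable_smul (realPart L φ).continuous (realPart L φ).hasCompactSupport K,
      integrable_smul (partialD_continuous i _) (partialD_hasCompactSupport i _) G,
      hG (realPart L φ)⟩
  obtain ⟨r1, r2, r3⟩ := key Complex.reCLM
  obtain ⟨m1, m2, m3⟩ := key Complex.imCLM
  simp only [Complex.reCLM_apply, Complex.imCLM_apply] at r1 r2 r3 m1 m2 m3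
  simp only [Set.mem_ofPred_eq]
  rw [inner_eq_integral_smul h1 r1 m1, inner_eq_integral_smul (h2 i) r2 m2, r3, m3]
  ring

lemma inner_eq_sum_comp (u v : L2Vector Ω) :
    inner ℂ u v = ∑ j, inner ℂ (comp Ω j u) (comp Ω j v) := by
  simp_rw [L2.inner_def]
  rw [← integral_finsetSum _ fun j _ => L2.integrable_inner (𝕜 := ℂ) _ _]
  have hc : ∀ (w : L2Vector Ω) (j : Fin d),
      comp Ω j w =ᵐ[volume.restrict (Ω : Set (Space d))] fun x => w x j :=
    fun w j => ContinuousLinearMap.coeFn_compLpL _ _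
  refine integral_congr_ae ?_
  filter_upwards [ae_all_iff.2 (hc u), ae_all_iff.2 (hc v)] with x hu hv
  rw [PiLp.inner_apply]
  exact Finset.sum_congr rfl fun j _ => by rw [hu, hv]

lemma norm_sq_eq_sum_comp (u : L2Vector Ω) : ‖u‖ ^ 2 = ∑ j, ‖comp Ω j u‖ ^ 2 := by
  have := inner_eq_sum_comp u u
  simp only [inner_self_eq_norm_sq_to_K] at this
  exact_mod_cast this

/-- Orthonormal fields in `H¹₀` with bounded gradients are bounded in number. -/
lemma exists_card_bound [IsFiniteMeasure (volume.restrict (Ω : Set (Space d)))] (M : ℝ) :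
    ∃ C : ℝ, ∀ (N : ℕ) (e : Fin N → L2Vector Ω) (g : Fin N → Fin d → Fin d → L2Scalar Ω),
      Orthonormal ℂ e → (∀ n j, (comp Ω j (e n), g n j) ∈ closure (testPairs Ω)) →
      (∀ n, ∑ j, ∑ i, ‖g n j i‖ ^ 2 ≤ M) → (N : ℝ) ≤ C := by
  obtain ⟨R, hR, hRM⟩ : ∃ R : ℝ, 0 < R ∧ (R ^ 2)⁻¹ * M ≤ 1 / 2 := by
    -- This radius leaves at most half of a unit vector's mass at frequencies above `R`.
    refine ⟨2 * |M| + 1, by positivity, ?_⟩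
    rw [inv_mul_le_iff₀ (by positivity)]
    nlinarith [le_abs_self M, abs_nonneg M]
  set B := Metric.closedBall (0 : Space d) R
  refine ⟨2 * ∑ j : Fin d, volume.real B
    * (‖ContinuousLinearMap.adjoint (comp Ω j)‖ ^ 2 * volume.real (Ω : Set (Space d))), ?_⟩
  intro N e g he hg hM
  have h1 : ∀ n, 1 / 2 ≤ ∑ j, lowFreq Ω R (comp Ω j (e n)) := by
    intro n
    have h2 : ‖e n‖ ^ 2 ≤ ∑ j, (lowFreq Ω R (comp Ω j (e n)) + (R ^ 2)⁻¹ * ∑ i, ‖g n j i‖ ^ 2) := by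
      rw [norm_sq_eq_sum_comp]
      exact Finset.sum_le_sum fun j _ => norm_sq_le_lowFreq_add (hg n j) hR
    rw [he.1 n, Finset.sum_add_distrib, ← Finset.mul_sum] at h2
    have h3 : (R ^ 2)⁻¹ * ∑ j, ∑ i, ‖g n j i‖ ^ 2 ≤ (R ^ 2)⁻¹ * M := by gcongr; exact hM n
    linarith
  have h2 : ∀ j, ∑ n, lowFreq Ω R (comp Ω j (e n)) ≤ volume.real B
      * (‖ContinuousLinearMap.adjoint (comp Ω j)‖ ^ 2 * volume.real (Ω : Set (Space d))) := by
    intro j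
    simp only [lowFreq]
    rw [← integral_finsetSum _ fun n _ => integrableOn_lowFreq Ω R _]
    refine (setIntegral_mono (integrable_finsetSum _ fun n _ => integrableOn_lowFreq Ω R _)
      (integrableOn_const (C := ‖ContinuousLinearMap.adjoint (comp Ω j)‖ ^ 2
        * volume.real (Ω : Set (Space d))) (isCompact_closedBall _ _).measure_lt_top.ne)
      fun ξ => ?_).trans_eq (by simp [B])
    -- Only the vector fields `e n` are orthonormal, not their components. The adjoint of `comp`
    -- moves the pairing to `L2Vector Ω`, where Bessel's inequality gives a bound independent of
    -- `N`.
    have h3 : ∀ n, ‖inner ℂ (planeWave Ω ξ) (comp Ω j (e n))‖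
        = ‖inner ℂ (e n) (ContinuousLinearMap.adjoint (comp Ω j) (planeWave Ω ξ))‖ := fun n => by
      rw [← ContinuousLinearMap.adjoint_inner_left, norm_inner_symm]
    simp_rw [h3]
    refine (he.sum_inner_products_le _).trans ?_
    rw [← norm_planeWave_sq Ω ξ, ← mul_pow]
    gcongr
    exact ContinuousLinearMap.le_opNorm _ _
  have h3 : ∑ n : Fin N, (1 / 2 : ℝ) ≤ ∑ n, ∑ j, lowFreq Ω R (comp Ω j (e n)) :=
    Finset.sum_le_sum fun n _ => h1 n
  rw [Finset.sum_comm] at h3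
  have h4 := h3.trans (Finset.sum_le_sum fun j _ => h2 j)
  simp only [Finset.sum_const, Finset.card_univ, Fintype.card_fin, nsmul_eq_mul] at h4
  linarith

end Parts

/-! ### Eigenvectors of the Stokes operator -/

section Stokes

variable {d : ℕ} {Ω : Opens (Space d)}

/-- The quadratic form of the Stokes operator. -/
lemma stokesGraph_inner {p q : solenoidal Ω × solenoidal Ω} (hp : p ∈ stokesGraph Ω)
    {g k : Fin d → Fin d → L2Scalar Ω}
    (hg : ∀ j, (comp Ω j p.1, g j) ∈ closure (testPairs Ω))
    (hk : ∀ j, (comp Ω j q.1, k j) ∈ closure (testPairs Ω)) :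
    inner ℂ (q.1 : L2Vector Ω) (p.2 : L2Vector Ω) = ∑ j, ∑ i, inner ℂ (k j i) (g j i) := by
  obtain ⟨_, _, L, h1, h2⟩ := hp
  -- The projection disappears because `q.1` already lies in `H`.
  have h3 : inner ℂ (q.1 : L2Vector Ω) (leray Ω L : L2Vector Ω) = inner ℂ (q.1 : L2Vector Ω) L :=
    Submodule.inner_orthogonalProjectionOnto_eq_of_mem_left q.1 L
  rw [h2, Submodule.coe_neg, inner_neg_right, h3, inner_eq_sum_comp, ← Finset.sum_neg_distrib]
  refine Finset.sum_congr rfl fun j _ => ?_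
  obtain ⟨G, K, hGK, hL⟩ := h1 j
  rw [hL, inner_sum, ← Finset.sum_neg_distrib]
  refine Finset.sum_congr rfl fun i _ => ?_
  -- Green's formula moves one derivative onto `q.1`. Uniqueness of weak derivatives identifies `G
  -- i` with the `H¹₀` gradient `g j i`.
  rw [inner_weakPartial_of_mem_closure (hk j) (hGK i).2, neg_neg,
    (hGK i).1.unique (hasWeakPartial_of_mem_closure (hg j) i)]

lemma exists_grad_of_mem_stokesGraph {p : solenoidal Ω × solenoidal Ω} (hp : p ∈ stokesGraph Ω) :
    ∃ g : Fin d → Fin d → L2Scalar Ω, ∀ j, (comp Ω j p.1, g j) ∈ closure (testPairs Ω) := by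
  choose g hg using hp.2.1.1
  exact ⟨g, hg⟩

lemma mem_eigenspace_stokesOp {μ : ℂ} {u : solenoidal Ω} :
    u ∈ eigenspace (stokesOp Ω) μ ↔ (u, μ • u) ∈ stokesGraph Ω := by
  rw [eigenspace, stokesOp_graph]
  rfl

/-- The Dirichlet form in `stokesGraph_inner` is Hermitian. -/
lemma stokesOp_symmetric {p q : solenoidal Ω × solenoidal Ω} (hp : p ∈ stokesGraph Ω)
    (hq : q ∈ stokesGraph Ω) :
    inner ℂ (q.1 : L2Vector Ω) (p.2 : L2Vector Ω)
      = inner ℂ (q.2 : L2Vector Ω) (p.1 : L2Vector Ω) := by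
  obtain ⟨g, hg⟩ := exists_grad_of_mem_stokesGraph hp
  obtain ⟨k, hk⟩ := exists_grad_of_mem_stokesGraph hq
  rw [stokesGraph_inner hp hg hk, ← inner_conj_symm (q.2 : L2Vector Ω), stokesGraph_inner hq hk hg]
  simp_rw [map_sum, inner_conj_symm]

/-- The energy identity for an eigenvector of the Stokes operator. -/
lemma eigenvalue_mul_norm_sq {μ : ℂ} {u : solenoidal Ω} (hu : u ∈ eigenspace (stokesOp Ω) μ)
    {g : Fin d → Fin d → L2Scalar Ω} (hg : ∀ j, (comp Ω j u, g j) ∈ closure (testPairs Ω)) :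
    μ * ((‖u‖ ^ 2 : ℝ) : ℂ) = ((∑ j, ∑ i, ‖g j i‖ ^ 2 : ℝ) : ℂ) := by
  have := stokesGraph_inner (q := (u, μ • u)) (mem_eigenspace_stokesOp.1 hu) hg hg
  simp only [Submodule.coe_smul, inner_smul_right, inner_self_eq_norm_sq_to_K] at this
  push_cast
  exact this

/-- The eigenvalues of the Stokes operator are real and positive. -/
lemma stokesOp_eigenvalue_pos [IsFiniteMeasure (volume.restrict (Ω : Set (Space d)))]
    (hd : d ≠ 0) {μ : ℂ} (h : IsEigenvalue (stokesOp Ω) μ) :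
    ∃ s : ℝ, 0 < s ∧ μ = s := by
  obtain ⟨u, hu, hu0⟩ := h
  obtain ⟨g, hg⟩ := exists_grad_of_mem_stokesGraph (mem_eigenspace_stokesOp.1 hu)
  have key := eigenvalue_mul_norm_sq hu hg
  have hn : 0 < ‖u‖ ^ 2 := by have := norm_pos_iff.2 hu0; positivity
  have hμ : μ = (((∑ j, ∑ i, ‖g j i‖ ^ 2) / ‖u‖ ^ 2 : ℝ) : ℂ) := by
    rw [Complex.ofReal_div, ← key, mul_div_cancel_right₀]
    exact_mod_cast hn.ne'
  -- The eigenvalue is the Rayleigh quotient. If its numerator were zero, all gradients would vanish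
  -- and so would `u`.
  refine ⟨_, div_pos (lt_of_le_of_ne (Finset.sum_nonneg fun j _ =>
    Finset.sum_nonneg fun i _ => sq_nonneg _) fun h0 => hu0 ?_) hn, hμ⟩
  have h1 : ∀ j, g j = 0 := fun j => by
    funext i
    have hj : ∀ j, 0 ≤ ∑ i, ‖g j i‖ ^ 2 := fun j => Finset.sum_nonneg fun i _ => sq_nonneg _
    have h2 : ∑ i, ‖g j i‖ ^ 2 = 0 := le_antisymm (h0 ▸ Finset.single_le_sum
      (f := fun j => ∑ i, ‖g j i‖ ^ 2) (fun j _ => hj j) (Finset.mem_univ j)) (hj j)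
    have h3 : ‖g j i‖ ^ 2 ≤ 0 := h2 ▸ Finset.single_le_sum
      (f := fun i => ‖g j i‖ ^ 2) (fun i _ => sq_nonneg _) (Finset.mem_univ i)
    exact norm_eq_zero.1 (pow_eq_zero_iff two_ne_zero |>.1 (le_antisymm h3 (sq_nonneg _)))
  refine Subtype.ext (comp_injective fun j => eq_zero_of_grad_eq_zero hd ?_)
  rw [← h1 j]
  exact hg j

lemma inner_eq_zero_of_eigenvalue_ne {s t : ℝ} (hst : s ≠ t) {u v : solenoidal Ω}
    (hu : u ∈ eigenspace (stokesOp Ω) s) (hv : v ∈ eigenspace (stokesOp Ω) t) :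
    inner ℂ (u : L2Vector Ω) (v : L2Vector Ω) = 0 := by
  have h := stokesOp_symmetric (mem_eigenspace_stokesOp.1 hv) (mem_eigenspace_stokesOp.1 hu)
  simp only [Submodule.coe_smul, inner_smul_right, inner_smul_left, Complex.conj_ofReal] at h
  have h' : ((t : ℂ) - s) * inner ℂ (u : L2Vector Ω) (v : L2Vector Ω) = 0 := by rw [sub_mul, h, sub_self]
  refine (mul_eq_zero.1 h').resolve_left fun h0 => hst ?_
  exact_mod_cast (sub_eq_zero.1 h0).symm

/-- Orthonormal eigenvectors with bounded eigenvalues are bounded in number. -/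
lemma exists_card_eigenvector_bound [IsFiniteMeasure (volume.restrict (Ω : Set (Space d)))]
    (M : ℝ) : ∃ C : ℕ, ∀ (N : ℕ) (e : Fin N → solenoidal Ω) (s : Fin N → ℝ),
      Orthonormal ℂ (fun n => (e n : L2Vector Ω)) →
      (∀ n, e n ∈ eigenspace (stokesOp Ω) (s n)) → (∀ n, s n ≤ M) → N ≤ C := by
  obtain ⟨C, hC⟩ := exists_card_bound (Ω := Ω) M
  refine ⟨⌊C⌋₊, fun N e s he hes hs => Nat.le_floor ?_⟩
  choose g hg using fun n => exists_grad_of_mem_stokesGraph (mem_eigenspace_stokesOp.1 (hes n))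
  refine hC N (fun n => e n) g he hg fun n => ?_
  · have := eigenvalue_mul_norm_sq (hes n) (hg n)
    rw [show ‖e n‖ = 1 from he.1 n, one_pow, Complex.ofReal_one, mul_one] at this
    rw [← Complex.ofReal_injective this]
    exact hs n

/-- A value is listed at least once exactly when its multiplicity is nonzero, since
`Cardinal.toENat` vanishes only at `0`. -/
lemma IsEigenvalueSequence.isEigenvalue {σ : ℕ → ℝ} {X : Type} [AddCommGroup X] [Module ℂ X]
    {A : X →ₗ.[ℂ] X} (hσ : IsEigenvalueSequence A σ) (s : ℝ) :
    IsEigenvalue A s ↔ s ∈ Set.range σ := by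
  have h1 : IsEigenvalue A s ↔ Module.rank ℂ (eigenspace A (s : ℂ)) ≠ 0 := by
    rw [Ne, rank_zero_iff, not_subsingleton_iff_nontrivial, Submodule.nontrivial_iff_ne_bot,
      Submodule.ne_bot_iff]
    rfl
  have h2 : s ∈ Set.range σ ↔ {k | σ k = s}.encard ≠ 0 := by
    rw [Set.encard_ne_zero]
    rfl
  rw [h1, h2, hσ.2 s]
  simp

/-- Gram–Schmidt on `N` independent vectors of `W`; it also covers eigenspaces of infinite rank. -/
lemma exists_orthonormal_of_le_rank {E : Type} [NormedAddCommGroup E] [InnerProductSpace ℂ E]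
    (W : Submodule ℂ E) {N : ℕ} (h : (N : Cardinal) ≤ Module.rank ℂ W) :
    ∃ e : Fin N → E, Orthonormal ℂ e ∧ ∀ n, e n ∈ W := by
  obtain ⟨f, hf⟩ := exists_linearIndependent_of_le_rank h
  exact ⟨fun n => (InnerProductSpace.gramSchmidtNormed ℂ f n : W),
    (InnerProductSpace.gramSchmidtNormed_orthonormal hf).comp_linearIsometry W.subtypeₗᵢ,
    fun n => (InnerProductSpace.gramSchmidtNormed ℂ f n : W).2⟩

lemma exists_unit_eigenvector {μ : ℂ} (h : IsEigenvalue (stokesOp Ω) μ) :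
    ∃ u ∈ eigenspace (stokesOp Ω) μ, ‖(u : L2Vector Ω)‖ = 1 := by
  obtain ⟨u, hu, hu0⟩ := h
  have hu1 : ‖(u : L2Vector Ω)‖ ≠ 0 := norm_ne_zero_iff.2 fun h => hu0 (Subtype.ext h)
  refine ⟨((‖(u : L2Vector Ω)‖⁻¹ : ℝ) : ℂ) • u, Submodule.smul_mem _ _ hu, ?_⟩
  rw [Submodule.coe_smul, norm_smul, Complex.norm_real, norm_inv, norm_norm, inv_mul_cancel₀ hu1]

/-- The eigenvalues of the Stokes operator tend to infinity. -/
lemma IsEigenvalueSequence.tendsto_atTop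
    [IsFiniteMeasure (volume.restrict (Ω : Set (Space d)))] {σ : ℕ → ℝ}
    (hσ : IsEigenvalueSequence (stokesOp Ω) σ) : Tendsto σ atTop atTop := by
  refine tendsto_atTop_atTop_of_monotone hσ.1 fun M => ?_
  by_contra! hM
  obtain ⟨C, hC⟩ := exists_card_eigenvector_bound (Ω := Ω) M
  suffices h : ∃ (e : Fin (C + 1) → solenoidal Ω) (s : Fin (C + 1) → ℝ),
      Orthonormal ℂ (fun n => (e n : L2Vector Ω)) ∧
      (∀ n, e n ∈ eigenspace (stokesOp Ω) (s n)) ∧ ∀ n, s n ≤ M by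
    obtain ⟨e, s, h1, h2, h3⟩ := h
    exact absurd (hC _ e s h1 h2 h3) (by simp)
  -- A bounded sequence has either a value repeated infinitely often, hence an infinite-dimensional
  -- eigenspace, or infinitely many distinct values, whose eigenvectors are orthogonal. Each case
  -- yields `C + 1` orthonormal eigenvectors, one too many.
  by_cases hfin : (Set.range σ).Finite
  · obtain ⟨s, hs, hs'⟩ : ∃ s ∈ Set.range σ, {k | σ k = s}.Infinite := by
      by_contra! hcon
      refine Set.infinite_univ (α := ℕ) ((hfin.biUnion hcon).subset fun k _ => ?_)
      simp
    have hrank := hσ.2 s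
    rw [hs'.encard_eq] at hrank
    have hrank' : Cardinal.aleph0 ≤ Module.rank ℂ (eigenspace (stokesOp Ω) (s : ℂ)) :=
      Cardinal.toENat_eq_top.1 hrank.symm
    obtain ⟨k, rfl⟩ := hs
    obtain ⟨e, he, heW⟩ := exists_orthonormal_of_le_rank
      (((eigenspace (stokesOp Ω) (σ k : ℂ))).map (solenoidal Ω).subtype) (N := C + 1) (by
        rw [← (Submodule.equivMapOfInjective (solenoidal Ω).subtype
          (solenoidal Ω).injective_subtype _).rank_eq]
        exact Cardinal.natCast_le_aleph0.trans hrank')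
    choose v hv hve using heW
    refine ⟨v, fun _ => σ k, ?_, hv, fun _ => (hM k).le⟩
    convert he using 1
    exact funext hve
  · obtain ⟨t, ht, htc⟩ := Set.Infinite.exists_subset_card_eq hfin (C + 1)
    let s : Fin (C + 1) → ℝ := fun n => (t.equivFinOfCardEq htc).symm n
    have hs : ∀ n, s n ∈ Set.range σ := fun n => ht ((t.equivFinOfCardEq htc).symm n).2
    have hinj : Function.Injective s :=
      Subtype.val_injective.comp (t.equivFinOfCardEq htc).symm.injective
    choose e he he1 using fun n => exists_unit_eigenvector ((hσ.isEigenvalue (s n)).2 (hs n))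
    refine ⟨e, s, ⟨he1, fun m n hmn => ?_⟩, he, fun n => ?_⟩
    · exact inner_eq_zero_of_eigenvalue_ne (fun h => hmn (hinj h)) (he m) (he n)
    · obtain ⟨k, hk⟩ := hs n
      rw [← hk]
      exact (hM k).le

end Stokes

/-! ### Eigenvalues of the principal operator -/

section Principal

variable {X : Type} [NormedAddCommGroup X] [InnerProductSpace ℂ X]

/-- The eigenvalues of the principal operator solve a quadratic equation over those of `A₀`. -/
lemma isEigenvalue_principalOp_iff (A₀ : X →ₗ.[ℂ] X) {η κ lam : ℝ} (hη : 0 < η) (hκ : 0 < κ)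
    (hlam : 0 < lam) (μ : ℂ) :
    IsEigenvalue (principalOp A₀ η κ lam) μ ↔ ∃ c : ℂ, IsEigenvalue A₀ c ∧
      μ ^ 2 + (lam + η * c) * μ + c * (η * lam + κ) = 0 := by
  have hη' : (η : ℂ) ≠ 0 := by exact_mod_cast hη.ne'
  have hκ' : (κ : ℂ) ≠ 0 := by exact_mod_cast hκ.ne'
  -- If both vanished, `μ = 0` would give `η lam + κ = 0`, and `μ = -lam` would give `κ = 0`.
  have hne : (η : ℂ) * (lam + μ) + κ = 0 → μ * (lam + μ) ≠ 0 := by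
    intro h h0
    rcases mul_eq_zero.1 h0 with h1 | h1
    · rw [h1, add_zero] at h
      have : 0 < η * lam + κ := by positivity
      exact this.ne' (by exact_mod_cast h)
    · rw [h1, mul_zero, zero_add] at h
      exact hκ' h
  constructor
  · rintro ⟨Y, hY, hY0⟩
    obtain ⟨hdom, hval⟩ := (mem_eigenspace _ _ _).1 hY
    have e1 : -A₀ ⟨(η : ℂ) • Y.fst + (κ : ℂ) • Y.snd, hdom⟩ = μ • Y.fst :=
      congrArg WithLp.fst hval
    have e2 : Y.fst - (lam : ℂ) • Y.snd = μ • Y.snd := congrArg WithLp.snd hval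
    have e3 : Y.fst = ((lam : ℂ) + μ) • Y.snd := by
      rw [add_smul, ← e2]
      abel
    have hw : Y.snd ≠ 0 := fun h => hY0 (by
      have h' : Y.fst = 0 := by rw [e3, h, smul_zero]
      exact (WithLp.ofLp_injective 2) (Prod.ext h' h))
    set q : ℂ := (η : ℂ) * (lam + μ) + κ with hq
    have e4 : (η : ℂ) • Y.fst + (κ : ℂ) • Y.snd = q • Y.snd := by
      rw [e3, smul_smul, ← add_smul]
    -- Only the combination `q • Y.snd` is known to lie in the domain. Working in the graph allows
    -- division by `q` once `q ≠ 0`; that holds because `A₀` sends `0` to `0`.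
    have e5 : (q • Y.snd, -((μ * (lam + μ)) • Y.snd)) ∈ A₀.graph := by
      rw [LinearPMap.mem_graph_iff]
      refine ⟨⟨_, hdom⟩, e4, ?_⟩
      rw [mul_smul, ← e3, ← e1, neg_neg]
    have hq0 : q ≠ 0 := by
      intro h0
      rw [h0, zero_smul] at e5
      have := A₀.graph_fst_eq_zero_snd e5 rfl
      exact hne h0 ((smul_eq_zero.1 (neg_eq_zero.1 this)).resolve_right hw)
    refine ⟨-(μ * (lam + μ)) / q, ⟨Y.snd, ?_, hw⟩, ?_⟩
    · have := A₀.graph.smul_mem q⁻¹ e5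
      rw [Prod.smul_mk, smul_smul, inv_mul_cancel₀ hq0, one_smul, ← neg_smul, smul_smul] at this
      rw [eigenspace, Submodule.mem_comap]
      rw [div_eq_inv_mul]
      exact this
    · field_simp
      rw [hq]
      ring
  · rintro ⟨c, ⟨w, hw, hw0⟩, hc⟩
    obtain ⟨hdom, hval⟩ := (mem_eigenspace _ _ _).1 hw
    let Y : WithLp 2 (X × X) := WithLp.toLp 2 (((lam : ℂ) + μ) • w, w)
    have e4 : (η : ℂ) • Y.fst + (κ : ℂ) • Y.snd = ((η : ℂ) * (lam + μ) + κ) • w := by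
      simp only [Y, WithLp.toLp_fst, WithLp.toLp_snd]
      rw [smul_smul, ← add_smul]
    have hY : Y ∈ (principalOp A₀ η κ lam).domain := by
      change (η : ℂ) • Y.fst + (κ : ℂ) • Y.snd ∈ A₀.domain
      rw [e4]
      exact A₀.domain.smul_mem _ hdom
    refine ⟨Y, (mem_eigenspace _ _ _).2 ⟨hY, ?_⟩, fun h => hw0 (congrArg WithLp.snd h)⟩
    have e5 : A₀ ⟨(η : ℂ) • Y.fst + (κ : ℂ) • Y.snd, hY⟩
        = ((η : ℂ) * (lam + μ) + κ) • (c • w) := by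
      rw [← hval, ← LinearPMap.map_smul]
      congr 1
      exact Subtype.ext e4
    refine (WithLp.ofLp_injective 2) (Prod.ext ?_ ?_)
    · change -A₀ ⟨(η : ℂ) • Y.fst + (κ : ℂ) • Y.snd, hY⟩ = μ • (((lam : ℂ) + μ) • w)
      rw [e5, smul_smul, smul_smul, ← neg_smul]
      congr 1
      linear_combination -hc
    · change ((lam : ℂ) + μ) • w - (lam : ℂ) • w = μ • w
      rw [add_smul]
      abel

end Principal

/-! ### The roots `μ⁺` and `μ⁻` -/

section Roots

-- `Real.sqrt` is zero on negative numbers, so one summand always vanishes. This gives real and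
-- imaginary parts of the roots without a case split on the sign of the discriminant.
open scoped ComplexOrder in
lemma complex_sqrt_ofReal (D : ℝ) :
    Complex.sqrt (D : ℂ) = (√D : ℝ) + (√(-D) : ℝ) * Complex.I := by
  rcases le_total 0 D with h | h
  · rw [Complex.sqrt_of_nonneg (by exact_mod_cast h), Real.sqrt_eq_zero'.2 (neg_nonpos.2 h)]
    simp
  · have hD : (0 : ℂ) ≤ ((-D : ℝ) : ℂ) := by exact_mod_cast neg_nonneg.2 h
    have := Complex.sqrt_neg_of_nonneg hD
    rw [Complex.sqrt_of_nonneg hD, Complex.ofReal_neg, neg_neg, ← Complex.ofReal_neg,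
      Complex.ofReal_re] at this
    rw [this, Real.sqrt_eq_zero'.2 h]
    simp [mul_comm]

lemma complex_sqrt_sq (a : ℂ) : Complex.sqrt a ^ 2 = a := by
  rw [Complex.sqrt, ← Complex.cpow_nat_mul]
  simp

variable (η κ lam s : ℝ)

lemma muPlus_re : (muPlus η κ lam s).re = (-(lam + η * s) + √(discr η κ lam s)) / 2 := by
  rw [muPlus, complex_sqrt_ofReal, ← Complex.ofReal_ofNat, Complex.div_ofReal_re]
  simp

lemma muMinus_re : (muMinus η κ lam s).re = (-(lam + η * s) - √(discr η κ lam s)) / 2 := by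
  rw [muMinus, complex_sqrt_ofReal, ← Complex.ofReal_ofNat, Complex.div_ofReal_re]
  simp

lemma muPlus_im : (muPlus η κ lam s).im = √(-discr η κ lam s) / 2 := by
  rw [muPlus, complex_sqrt_ofReal, ← Complex.ofReal_ofNat, Complex.div_ofReal_im]
  simp

lemma muMinus_im : (muMinus η κ lam s).im = -√(-discr η κ lam s) / 2 := by
  rw [muMinus, complex_sqrt_ofReal, ← Complex.ofReal_ofNat, Complex.div_ofReal_im]
  simp

lemma muPlus_im_ne_zero_iff : (muPlus η κ lam s).im ≠ 0 ↔ discr η κ lam s < 0 := by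
  rw [muPlus_im, Ne, div_eq_zero_iff, Real.sqrt_eq_zero']
  simp

lemma muMinus_im_ne_zero_iff : (muMinus η κ lam s).im ≠ 0 ↔ discr η κ lam s < 0 := by
  rw [muMinus_im, Ne, div_eq_zero_iff, neg_eq_zero, Real.sqrt_eq_zero']
  simp

lemma muPlus_add_muMinus :
    muPlus η κ lam s + muMinus η κ lam s = -(lam + η * s) := by
  rw [muPlus, muMinus]
  push_cast
  ring

lemma muPlus_mul_muMinus :
    muPlus η κ lam s * muMinus η κ lam s = s * (η * lam + κ) := by
  have h := complex_sqrt_sq (discr η κ lam s : ℂ)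
  rw [muPlus, muMinus]
  have h' : (discr η κ lam s : ℂ) = (lam + η * s) ^ 2 - 4 * s * (η * lam + κ) := by
    rw [discr]
    push_cast
    ring
  push_cast
  linear_combination (-1 / 4 : ℂ) * h - (1 / 4 : ℂ) * h'

lemma quadratic_eq_zero_iff_muPlus_or_muMinus (μ : ℂ) :
    μ ^ 2 + (lam + η * s) * μ + s * (η * lam + κ) = 0 ↔
      μ = muPlus η κ lam s ∨ μ = muMinus η κ lam s := by
  have h : μ ^ 2 + (lam + η * s) * μ + s * (η * lam + κ)
      = (μ - muPlus η κ lam s) * (μ - muMinus η κ lam s) := by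
    linear_combination μ * muPlus_add_muMinus η κ lam s - muPlus_mul_muMinus η κ lam s
  rw [h, mul_eq_zero, sub_eq_zero, sub_eq_zero]

variable {η κ lam s}

lemma discr_neg_iff (hη : 0 < η) (hκ : 0 < κ) (hlam : 0 < lam) : discr η κ lam s < 0 ↔
    ((η * lam + 2 * κ) - 2 * √(κ ^ 2 + κ * η * lam)) / η ^ 2 < s ∧
      s < ((η * lam + 2 * κ) + 2 * √(κ ^ 2 + κ * η * lam)) / η ^ 2 := by
  have hη2 : 0 < η ^ 2 := by positivity
  rw [div_lt_iff₀ hη2, lt_div_iff₀ hη2]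
  set r := √(κ ^ 2 + κ * η * lam) with hr
  have hr2 : r ^ 2 = κ ^ 2 + κ * η * lam := Real.sq_sqrt (by positivity)
  have hr0 : 0 ≤ r := Real.sqrt_nonneg _
  -- Completing the square in `s`.
  have key : η ^ 2 * discr η κ lam s = (s * η ^ 2 - (η * lam + 2 * κ)) ^ 2 - (2 * r) ^ 2 := by
    rw [mul_pow 2 r, hr2, discr]
    ring
  have h1 : discr η κ lam s < 0 ↔ (s * η ^ 2 - (η * lam + 2 * κ)) ^ 2 < (2 * r) ^ 2 := by
    rw [← sub_neg (a := _ ^ 2), ← key]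
    exact (smul_neg_iff_of_pos_left hη2).symm
  rw [h1, sq_lt_sq, abs_of_nonneg (a := 2 * r) (by positivity), abs_lt]
  constructor <;> rintro ⟨h2, h3⟩ <;> constructor <;> linarith

lemma muPlus_re_neg (hη : 0 < η) (hκ : 0 < κ) (hlam : 0 < lam) (hs : 0 < s) :
    (muPlus η κ lam s).re < 0 := by
  rw [muPlus_re]
  have : √(discr η κ lam s) < lam + η * s := by
    rw [Real.sqrt_lt' (by positivity), discr]
    have : 0 < 4 * s * (η * lam + κ) := by positivity
    linarith
  linarith

lemma muMinus_re_neg (hη : 0 < η) (hlam : 0 < lam) (hs : 0 < s) :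
    (muMinus η κ lam s).re < 0 := by
  rw [muMinus_re]
  have : 0 < η * s := by positivity
  linarith [Real.sqrt_nonneg (discr η κ lam s)]

/-- With `a = lam + η s - 2 ν₀`, the real parts shifted by `ν₀` are `(-a ± √D) / 2`. Since `a² - D =
4 (κ/η) ν₀ > 0`, the root is dominated by `|a|` and the sign of `a` decides. -/
lemma re_le_of_threshold_le (hη : 0 < η) (hκ : 0 < κ) (hlam : 0 < lam)
    (h : 2 * (κ / η + lam) ≤ lam + η * s) :
    (muPlus η κ lam s).re ≤ -(κ / η + lam) ∧ (muMinus η κ lam s).re ≤ -(κ / η + lam) := by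
  rw [muPlus_re, muMinus_re]
  have h0 := Real.sqrt_nonneg (discr η κ lam s)
  have h1 : √(discr η κ lam s) ≤ lam + η * s - 2 * (κ / η + lam) := by
    refine Real.sqrt_le_iff.2 ⟨by linarith, ?_⟩
    have e : (lam + η * s - 2 * (κ / η + lam)) ^ 2 - discr η κ lam s
        = 4 * (κ / η) * (κ / η + lam) := by
      rw [discr]
      field_simp
      ring
    have : 0 < 4 * (κ / η) * (κ / η + lam) := by positivity
    linarith
  constructor <;> linarith

lemma lt_re_of_lt_threshold (hη : 0 < η) (hκ : 0 < κ) (hlam : 0 < lam)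
    (h : lam + η * s < 2 * (κ / η + lam)) :
    -(κ / η + lam) < (muPlus η κ lam s).re ∧ -(κ / η + lam) < (muMinus η κ lam s).re := by
  rw [muPlus_re, muMinus_re]
  have h0 := Real.sqrt_nonneg (discr η κ lam s)
  have h1 : √(discr η κ lam s) < 2 * (κ / η + lam) - (lam + η * s) := by
    rw [Real.sqrt_lt' (by linarith)]
    have e : (2 * (κ / η + lam) - (lam + η * s)) ^ 2 - discr η κ lam s
        = 4 * (κ / η) * (κ / η + lam) := by
      rw [discr]
      field_simp
      ring
    have : 0 < 4 * (κ / η) * (κ / η + lam) := by positivity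
    linarith
  constructor <;> linarith

/-- The choice of `ν₀` cancels every term in `s`, because `η ν₀ = η lam + κ`. -/
lemma muPlus_add_mul_muMinus_add (hη : 0 < η) :
    (muPlus η κ lam s + ((κ / η + lam : ℝ) : ℂ)) * (muMinus η κ lam s + ((κ / η + lam : ℝ) : ℂ))
      = (((κ / η) * (κ / η + lam) : ℝ) : ℂ) := by
  have hη' : (η : ℂ) ≠ 0 := by exact_mod_cast hη.ne'
  have h1 := muPlus_add_muMinus η κ lam s
  have h2 := muPlus_mul_muMinus η κ lam s
  push_cast
  have h3 : (η : ℂ) * (κ / η) = κ := by field_simp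
  linear_combination h2 + ((κ / η : ℂ) + lam) * h1 + (-s : ℂ) * h3

variable {σ : ℕ → ℝ}

lemma tendsto_muMinus_re (hη : 0 < η) (hσ : Tendsto σ atTop atTop) :
    Tendsto (fun k => (muMinus η κ lam (σ k)).re) atTop atBot := by
  have h : Tendsto (fun k => (-(lam + η * σ k)) / 2) atTop atBot :=
    (tendsto_neg_atTop_atBot.comp (tendsto_atTop_add_const_left _ _
      (hσ.const_mul_atTop hη))).atBot_div_const two_pos
  refine tendsto_atBot_mono (fun k => ?_) h
  rw [muMinus_re]
  linarith [Real.sqrt_nonneg (discr η κ lam (σ k))]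

/-- The shifted roots have a fixed product and the second is unbounded in norm, so the first tends
to zero. -/
lemma tendsto_muPlus (hη : 0 < η) (hκ : 0 < κ) (hlam : 0 < lam) (hσ : Tendsto σ atTop atTop) :
    Tendsto (fun k => muPlus η κ lam (σ k)) atTop (𝓝 ((-(κ / η + lam) : ℝ) : ℂ)) := by
  have h1 : Tendsto (fun k => muMinus η κ lam (σ k) + ((κ / η + lam : ℝ) : ℂ)) atTop
      (Bornology.cobounded ℂ) := by
    rw [← tendsto_norm_atTop_iff_cobounded]
    refine tendsto_atTop_mono (fun k => (neg_le_abs _).trans (Complex.abs_re_le_norm _)) ?_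
    simp only [Complex.add_re, Complex.ofReal_re]
    exact tendsto_neg_atBot_atTop.comp (tendsto_atBot_add_const_right _ _
      (tendsto_muMinus_re hη hσ))
  have h2 := ((tendsto_inv₀_cobounded.comp h1).const_mul
    (((κ / η) * (κ / η + lam) : ℝ) : ℂ)).sub_const ((κ / η + lam : ℝ) : ℂ)
  rw [mul_zero, zero_sub, ← Complex.ofReal_neg] at h2
  refine h2.congr fun k => ?_
  have hne : muMinus η κ lam (σ k) + ((κ / η + lam : ℝ) : ℂ) ≠ 0 := by
    intro h0
    have h := muPlus_add_mul_muMinus_add (κ := κ) (lam := lam) (s := σ k) hη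
    rw [h0, mul_zero] at h
    have h3 : 0 < (κ / η) * (κ / η + lam) := by positivity
    exact h3.ne (by exact_mod_cast h)
  rw [← muPlus_add_mul_muMinus_add (s := σ k) hη, Function.comp_apply, mul_inv_cancel_right₀ hne,
    add_sub_cancel_right]

/-- By the sum of the roots, `μ⁻ + η σ k = -lam - μ⁺`. This is bounded since `μ⁺` converges, while
`η σ k → ∞`. -/
lemma isEquivalent_muMinus (hη : 0 < η) (hκ : 0 < κ) (hlam : 0 < lam)
    (hσ : Tendsto σ atTop atTop) :
    Asymptotics.IsEquivalent atTop (fun k => muMinus η κ lam (σ k))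
      (fun k => ((-η * σ k : ℝ) : ℂ)) := by
  have h1 : (fun k => muMinus η κ lam (σ k)) - (fun k => ((-η * σ k : ℝ) : ℂ))
      = fun k => -(lam : ℂ) - muPlus η κ lam (σ k) := by
    funext k
    have := muPlus_add_muMinus η κ lam (σ k)
    simp only [Pi.sub_apply]
    push_cast
    linear_combination this
  rw [Asymptotics.IsEquivalent, h1]
  have h2 : (fun k => -(lam : ℂ) - muPlus η κ lam (σ k)) =O[atTop] fun _ => (1 : ℝ) :=
    ((tendsto_muPlus hη hκ hlam hσ).const_sub _).isBigO_one ℝ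
  refine h2.trans_isLittleO ?_
  rw [Asymptotics.isLittleO_one_left_iff]
  refine tendsto_atTop_mono (fun k => ?_) (hσ.const_mul_atTop hη)
  rw [Complex.norm_real, Real.norm_eq_abs, neg_mul, abs_neg]
  exact le_abs_self _

end Roots

end StokesMemory

/-! ### Assembly of the spectral theorem -/

open StokesMemory in
theorem theorem2p2 {d : ℕ} (hd : d = 2 ∨ d = 3) (Ω : Opens (Space d))
    (hΩ_conn : IsConnected (Ω : Set (Space d)))
    (hΩ_bdd : Bornology.IsBounded (Ω : Set (Space d)))
    (hΩ_bdry : HasC2Boundary Ω)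
    (η κ lam : ℝ) (hη : 0 < η) (hκ : 0 < κ) (hlam : 0 < lam)
    (σ : ℕ → ℝ) (hσ : IsEigenvalueSequence (stokesOp Ω) σ) :
    -- the eigenvalues of the principal operator
    {μ : ℂ | IsEigenvalue (principalOp (stokesOp Ω) η κ lam) μ}
        = Set.range (fun k => muPlus η κ lam (σ k)) ∪ Set.range (fun k => muMinus η κ lam (σ k)) ∧
    -- (a)
    {μ : ℂ | IsEigenvalue (principalOp (stokesOp Ω) η κ lam) μ ∧ μ.im ≠ 0}.Finite ∧
    {k : ℕ | (muPlus η κ lam (σ k)).im ≠ 0 ∨ (muMinus η κ lam (σ k)).im ≠ 0}.Finite ∧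
    (∀ k, ((muPlus η κ lam (σ k)).im ≠ 0 ↔
        ((η * lam + 2 * κ) - 2 * √(κ ^ 2 + κ * η * lam)) / η ^ 2 < σ k ∧
          σ k < ((η * lam + 2 * κ) + 2 * √(κ ^ 2 + κ * η * lam)) / η ^ 2)) ∧
    (∀ k, ((muMinus η κ lam (σ k)).im ≠ 0 ↔
        ((η * lam + 2 * κ) - 2 * √(κ ^ 2 + κ * η * lam)) / η ^ 2 < σ k ∧
          σ k < ((η * lam + 2 * κ) + 2 * √(κ ^ 2 + κ * η * lam)) / η ^ 2)) ∧
    -- (b)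
    Tendsto (fun k => muPlus η κ lam (σ k)) atTop (𝓝 ((-(κ / η + lam) : ℝ) : ℂ)) ∧
    Asymptotics.IsEquivalent atTop (fun k => muMinus η κ lam (σ k))
      (fun k => ((-η * σ k : ℝ) : ℂ)) ∧
    Tendsto (fun k => (muMinus η κ lam (σ k)).re) atTop atBot ∧
    -- (c)
    (∀ μ : ℂ, IsEigenvalue (principalOp (stokesOp Ω) η κ lam) μ → μ.re < 0) ∧
    (∃ N₁ : ℕ,
      (∀ k < N₁, -(κ / η + lam) < (muPlus η κ lam (σ k)).re ∧ (muPlus η κ lam (σ k)).re < 0) ∧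
      ∀ k, N₁ ≤ k → (muPlus η κ lam (σ k)).re ≤ -(κ / η + lam)) ∧
    (∃ N₂ : ℕ,
      (∀ k < N₂, -(κ / η + lam) < (muMinus η κ lam (σ k)).re ∧ (muMinus η κ lam (σ k)).re < 0) ∧
      ∀ k, N₂ ≤ k → (muMinus η κ lam (σ k)).re ≤ -(κ / η + lam)) ∧
    {μ : ℂ | IsEigenvalue (principalOp (stokesOp Ω) η κ lam) μ ∧ -(κ / η + lam) < μ.re}.Finite := by
  have hfin : IsFiniteMeasure (volume.restrict (Ω : Set (Space d))) :=
    ⟨by simpa using hΩ_bdd.measure_lt_top⟩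
  have hd0 : d ≠ 0 := by omega
  have hlim := hσ.tendsto_atTop
  have hpos : ∀ k, 0 < σ k := fun k => by
    obtain ⟨s, hs, hsk⟩ := stokesOp_eigenvalue_pos hd0 ((hσ.isEigenvalue (σ k)).2 ⟨k, rfl⟩)
    rwa [Complex.ofReal_injective hsk]
  have hmem : ∀ μ, IsEigenvalue (principalOp (stokesOp Ω) η κ lam) μ ↔
      ∃ k, μ = muPlus η κ lam (σ k) ∨ μ = muMinus η κ lam (σ k) := by
    intro μ
    rw [isEigenvalue_principalOp_iff _ hη hκ hlam]
    constructor
    · rintro ⟨c, hc, hq⟩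
      obtain ⟨s, -, rfl⟩ := stokesOp_eigenvalue_pos hd0 hc
      obtain ⟨k, rfl⟩ := (hσ.isEigenvalue s).1 hc
      exact ⟨k, (quadratic_eq_zero_iff_muPlus_or_muMinus η κ lam (σ k) μ).1 hq⟩
    · rintro ⟨k, hk⟩
      exact ⟨σ k, (hσ.isEigenvalue (σ k)).2 ⟨k, rfl⟩,
        (quadratic_eq_zero_iff_muPlus_or_muMinus η κ lam (σ k) μ).2 hk⟩
  have hfinite : ∀ (p : ℂ → Prop) (S : Set ℕ), S.Finite →
      (∀ k, p (muPlus η κ lam (σ k)) → k ∈ S) → (∀ k, p (muMinus η κ lam (σ k)) → k ∈ S) →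
      {μ : ℂ | IsEigenvalue (principalOp (stokesOp Ω) η κ lam) μ ∧ p μ}.Finite := by
    intro p S hS h1 h2
    refine ((hS.image fun k => muPlus η κ lam (σ k)).union
      (hS.image fun k => muMinus η κ lam (σ k))).subset ?_
    rintro μ ⟨hμ, hp⟩
    obtain ⟨k, rfl | rfl⟩ := (hmem μ).1 hμ
    · exact Or.inl ⟨k, h1 k hp, rfl⟩
    · exact Or.inr ⟨k, h2 k hp, rfl⟩
  have hplus := fun k => (muPlus_im_ne_zero_iff η κ lam (σ k)).trans (discr_neg_iff hη hκ hlam)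
  have hminus := fun k => (muMinus_im_ne_zero_iff η κ lam (σ k)).trans (discr_neg_iff hη hκ hlam)
  have hnonreal :
      {k : ℕ | (muPlus η κ lam (σ k)).im ≠ 0 ∨ (muMinus η κ lam (σ k)).im ≠ 0}.Finite := by
    obtain ⟨N, hN⟩ := eventually_atTop.1 (hlim.eventually_ge_atTop
      (((η * lam + 2 * κ) + 2 * √(κ ^ 2 + κ * η * lam)) / η ^ 2))
    refine (Set.finite_lt_nat N).subset fun k hk => ?_
    by_contra! hNk
    have h1 : σ k < ((η * lam + 2 * κ) + 2 * √(κ ^ 2 + κ * η * lam)) / η ^ 2 := by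
      rcases hk with hk | hk
      · exact ((hplus k).1 hk).2
      · exact ((hminus k).1 hk).2
    exact absurd h1 (not_lt.2 (hN k (not_lt.1 hNk)))
  -- The first index past the threshold serves as both `N₁` and `N₂`. Monotonicity of `σ` keeps all
  -- later indices past it. Indices start at `0`, so this index may be `0`; counting from `1` adds
  -- one to it.
  have hex : ∃ N, 2 * (κ / η + lam) ≤ lam + η * σ N :=
    ((tendsto_atTop_add_const_left _ lam (hlim.const_mul_atTop hη)).eventually_ge_atTop _).exists
  classical
  have hbelow : ∀ k < Nat.find hex, lam + η * σ k < 2 * (κ / η + lam) := fun k hk =>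
    not_le.1 (Nat.find_min hex hk)
  have habove : ∀ k, Nat.find hex ≤ k → 2 * (κ / η + lam) ≤ lam + η * σ k := fun k hk =>
    (Nat.find_spec hex).trans (by gcongr; exact hσ.1 hk)
  refine ⟨?_, hfinite _ _ hnonreal (fun k h => Or.inl h) (fun k h => Or.inr h), hnonreal,
    hplus, hminus, tendsto_muPlus hη hκ hlam hlim, isEquivalent_muMinus hη hκ hlam hlim,
    tendsto_muMinus_re hη hlim, ?_, ⟨Nat.find hex, fun k hk =>
      ⟨(lt_re_of_lt_threshold hη hκ hlam (hbelow k hk)).1, muPlus_re_neg hη hκ hlam (hpos k)⟩,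
      fun k hk => (re_le_of_threshold_le hη hκ hlam (habove k hk)).1⟩, ⟨Nat.find hex, fun k hk =>
      ⟨(lt_re_of_lt_threshold hη hκ hlam (hbelow k hk)).2, muMinus_re_neg hη hlam (hpos k)⟩,
      fun k hk => (re_le_of_threshold_le hη hκ hlam (habove k hk)).2⟩,
    hfinite _ _ (Set.finite_lt_nat (Nat.find hex)) (fun k h => ?_) (fun k h => ?_)⟩
  · ext μ
    rw [Set.mem_ofPred_eq, hmem μ, exists_or]
    simp [eq_comm]
  · intro μ hμ
    obtain ⟨k, rfl | rfl⟩ := (hmem μ).1 hμ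
    · exact muPlus_re_neg hη hκ hlam (hpos k)
    · exact muMinus_re_neg hη hlam (hpos k)
  · by_contra! hk
    exact absurd h (not_lt.2 (re_le_of_threshold_le hη hκ hlam (habove k (not_lt.1 hk))).1)
  · by_contra! hk
    exact absurd h (not_lt.2 (re_le_of_threshold_le hη hκ hlam (habove k (not_lt.1 hk))).2)
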